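/- Setting. Let \(Q\) be a probability measure and let \((X_t)_{t\ge 0}\), \(X_0=0\), be a one-dimensional Lévy process under \(Q\) with characteristic exponent \(\psi\), i.e. \(E[e^{i\xi X_t}]=e^{-t\psi(\xi)}\) for \(\xi\in\mathbb R\), \(t\ge 0\). Assume that \(X\) is a regular Lévy process of exponential type (RLPE) of order \(\upsilon\in\,]0,2]\) and exponential type \([\lambda_-,\lambda_+]\), \(\lambda_-<0<\lambda_+\): on the strip \(\operatorname{Im}\xi\in[\lambda_-,\lambda_+]\) one has \(\psi(\xi)=-i\mu\xi+\phi(\xi)\) with \(\mu\in\mathbb R\) and \(\phi\) holomorphic in the open strip and continuous up to its boundary, \(\phi(\xi)=C|\xi|^{\upsilon}+O(|\xi|^{\upsilon_1})\) as \(|\xi|\to\infty\) in the strip with \(C>0\), and \(|\phi'(\xi)|\le C'(1+|\xi|^{\upsilon_2})\) in the strip, where \(\upsilon_1,\upsilon_2<\upsilon\). The stock price is \(S_t=e^{X_t}\), the interest rate is \(r\ge 0\), \(\lambda_-<-1\), and \(Q\) is a martingale measure: \(r+\psi(-i)=0\). Let \(0\le t=T_0<T_1<\dots<T_M\), put \(X_k=X_{T_k}\)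 and \(\mathbf X=(X_1,\dots,X_M)\). Let \(\gamma\in\mathbb R^M\), \(\mathbf K\in\mathbb R^N\), \(W=\operatorname{diag}(w_1,\dots,w_N)\) with \(w_n=\pm1\), and let \(A=(a_{nk})\) be a real \(N\times M\) matrix none of whose rows is zero. Consider the option that pays at time \(T_M\) the amount \[ g(\mathbf X)=\exp\Bigl(\sum_{k=1}^M\gamma_kX_k\Bigr)\,\mathbf 1_N(WA\mathbf X\ge W\mathbf K), \] where \(\mathbf 1_N(\mathbf Y\ge\mathbf Z)=\prod_{n=1}^N\mathbf 1(Y_n\ge Z_n)\). Its value at time \(t\), when the stock price is \(S_t\), is \(F(S_t,t)=E\bigl[e^{-r(T_M-t)}g(\mathbf X)\mid X_t=\ln S_t\bigr]\). Proposition 1. Let \(\omega_1,\dots,\omega_N>0\) be such that \[ \sum_{k=j}^M\Bigl[\sum_{n=1}^N w_n\omega_na_{nk}+\gamma_k\Bigr]\in\,]-\lambda_+,-\lambda_-[\qquad\text{for } j=1,\dots,M . \] Then the discounted payoff is integrable, the integral below converges absolutely, and \[ \begin{aligned} F(S_t,t)={}&\frac{e^{-r(T_M-t)}}{(2\pi i)^N}\,S_t^{\sum_{k=1}^M\gamma_k}\prod_{n=1}^Nw_n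 \int_{-\infty-iw_N\omega_N}^{+\infty-iw_N\omega_N}\!\!\cdots\int_{-\infty-iw_1\omega_1}^{+\infty-iw_1\omega_1}\frac1{\prod_{n=1}^N\xi_n}\\ &\times\exp\Bigl[i\sum_{n=1}^N\xi_n\Bigl(\sum_{k=1}^Ma_{nk}\ln S_t-K_n\Bigr)-\Psi(t,\xi_1,\dots,\xi_N)\Bigr]\,d\xi_1\cdots d\xi_N , \end{aligned} \] where \[ \Psi(t,\xi_1,\dots,\xi_N)=\sum_{j=1}^M(T_j-T_{j-1})\,\psi\Bigl(\sum_{n=1}^N\sum_{k=j}^Ma_{nk}\xi_n-i\sum_{k=j}^M\gamma_k\Bigr). \] This holds for every value \(S_t=s>0\), with \(F(s,t)\) the expectation of the discounted payoff when \(X_{T_k}\) is replaced by \(\ln s+X_{T_k}-X_t\); and it holds almost surely at \(S_t=e^{X_t}\), with \(F\) the conditional expectation of the discounted payoff given \(X_t\). -/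

import Mathlib

open MeasureTheory ProbabilityTheory Filter Topology
open scoped NNReal

noncomputable section

namespace LevyPricing

/-- A one-dimensional Lévy process under `Q`: it starts at `0`, has independent and stationary
increments, and is continuous in probability. -/
structure IsLevyProcess {Ω : Type*} [MeasurableSpace Ω] (Q : Measure Ω) (X : ℝ≥0 → Ω → ℝ) :
    Prop where
  measurable : ∀ t, Measurable (X t)
  start_zero : ∀ᵐ ω ∂Q, X 0 ω = 0
  indep_increments : HasIndepIncrements X Q
  stationary_increments :
    ∀ s h : ℝ≥0, IdentDistrib (fun ω ↦ X (s + h) ω - X s ω) (fun ω ↦ X h ω - X 0 ω) Q Q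
  continuous_in_probability : ∀ s, TendstoInMeasure Q X (𝓝 s) (X s)

/-- `ψ` is the characteristic exponent of `X` under `Q`:
`E[exp(i ξ X_t)] = exp(-t ψ(ξ))` for all real `ξ` and all `t ≥ 0`. -/
def HasCharExponent {Ω : Type*} [MeasurableSpace Ω] (Q : Measure Ω) (X : ℝ≥0 → Ω → ℝ)
    (ψ : ℂ → ℂ) : Prop :=
  ∀ (t : ℝ≥0) (ξ : ℝ),
    ∫ ω, Complex.exp (Complex.I * ξ * X t ω) ∂Q = Complex.exp (-(t : ℝ) * ψ ξ)

/-- The open strip `Im ξ ∈ ]lm, lp[`. -/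
def openStrip (lm lp : ℝ) : Set ℂ := {ξ | ξ.im ∈ Set.Ioo lm lp}

/-- The closed strip `Im ξ ∈ [lm, lp]`. -/
def closedStrip (lm lp : ℝ) : Set ℂ := {ξ | ξ.im ∈ Set.Icc lm lp}

/-- `ψ` is the exponent of a regular Lévy process of order `υ ∈ ]0,2]` and exponential type
`[lm, lp]`, `lm < 0 < lp`: on the closed strip `ψ(ξ) = -i μ ξ + φ(ξ)` with `φ` holomorphic in the
open strip and continuous up to its boundary, `φ(ξ) = C |ξ|^υ + O(|ξ|^υ₁)` as `|ξ| → ∞` in the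
strip, where `C > 0`, and `|φ'(ξ)| ≤ C' (1 + |ξ|^υ₂)` in the strip, with `υ₁, υ₂ < υ`. -/
def IsRLPEExponent (υ lm lp : ℝ) (ψ : ℂ → ℂ) : Prop :=
  υ ∈ Set.Ioc 0 2 ∧ lm < 0 ∧ 0 < lp ∧
  ∃ (μ : ℝ) (φ : ℂ → ℂ),
    (∀ ξ ∈ closedStrip lm lp, ψ ξ = -Complex.I * μ * ξ + φ ξ) ∧
    DifferentiableOn ℂ φ (openStrip lm lp) ∧
    ContinuousOn φ (closedStrip lm lp) ∧
    (∃ C > (0 : ℝ), ∃ υ₁ < υ,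
      (fun ξ : ℂ ↦ φ ξ - ((C * ‖ξ‖ ^ υ : ℝ) : ℂ))
        =O[Bornology.cobounded ℂ ⊓ 𝓟 (closedStrip lm lp)] fun ξ : ℂ ↦ ‖ξ‖ ^ υ₁) ∧
    (∃ C' : ℝ, ∃ υ₂ < υ, ∀ ξ ∈ openStrip lm lp, ‖deriv φ ξ‖ ≤ C' * (1 + ‖ξ‖ ^ υ₂))

/-- The Lévy market, under the pricing measure `Q`: savings account `exp(r t)` with `r ≥ 0`, stock
`S_t = exp(X_t)` with `X` a regular Lévy process of order `υ` and exponential type `[lm, lp]`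
with characteristic exponent `ψ`, `lm < -1`, and the martingale condition `r + ψ(-i) = 0`
on the discounted stock price. -/
structure IsRLPEMarket {Ω : Type*} [MeasurableSpace Ω] (Q : Measure Ω) (X : ℝ≥0 → Ω → ℝ)
    (r υ lm lp : ℝ) (ψ : ℂ → ℂ) : Prop where
  levy : IsLevyProcess Q X
  exponent : HasCharExponent Q X ψ
  rlpe : IsRLPEExponent υ lm lp ψ
  rate_nonneg : 0 ≤ r
  type_lt : lm < -1
  martingale_condition : (r : ℂ) + ψ (-Complex.I) = 0

open scoped Classical in
/-- The payoff `exp(∑ γ_k x_k) · 1(W A x ≥ W K)` of a generalized multi-period power digital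
option, as a function of the log-prices `x = (x_1, …, x_M)` at the monitoring dates. -/
def payoff {N M : ℕ} (γ : Fin M → ℝ) (K w : Fin N → ℝ) (A : Matrix (Fin N) (Fin M) ℝ)
    (x : Fin M → ℝ) : ℝ :=
  Real.exp (∑ k, γ k * x k) * ∏ n, if w n * K n ≤ w n * (A.mulVec x) n then 1 else 0

/-- The discounted payoff `exp(-r (T_M - t)) g(X_{T_1}, …, X_{T_M})`. The dates are
`T 0 = t` (the current date), `T 1 = T_1`, …, `T M = T_M`. -/
def discountedPayoff {Ω : Type*} {M : ℕ} (X : ℝ≥0 → Ω → ℝ) (r : ℝ) (T : Fin (M + 1) → ℝ≥0)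
    (g : (Fin M → ℝ) → ℝ) (ω : Ω) : ℝ :=
  Real.exp (-r * ((T (Fin.last M) : ℝ) - T 0)) * g (fun k ↦ X (T k.succ) ω)

/-- The discounted payoff when the log-price is moved to the value `log s` at the current date
`t = T 0` and then follows the increments of `X`. -/
def discountedPayoffFrom {Ω : Type*} {M : ℕ} (X : ℝ≥0 → Ω → ℝ) (r : ℝ) (T : Fin (M + 1) → ℝ≥0)
    (g : (Fin M → ℝ) → ℝ) (s : ℝ) (ω : Ω) : ℝ :=
  discountedPayoff (fun u ω' ↦ Real.log s + (X u ω' - X (T 0) ω')) r T g ω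

/-- The integrand of the pricing formula, at `ξ = (ξ_1, …, ξ_N) ∈ ℂ^N`, for the current
stock price `s`. -/
def pricingIntegrand {N M : ℕ} (ψ : ℂ → ℂ) (T : Fin (M + 1) → ℝ≥0) (γ : Fin M → ℝ)
    (K : Fin N → ℝ) (A : Matrix (Fin N) (Fin M) ℝ) (s : ℝ) (ξ : Fin N → ℂ) : ℂ :=
  1 / (∏ n, ξ n) *
    Complex.exp
      (Complex.I * ∑ n, ξ n * (((∑ k, A n k) * Real.log s - K n : ℝ) : ℂ)
        - ∑ j : Fin M, (((T j.succ : ℝ) - T j.castSucc : ℝ) : ℂ) *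
            ψ ((∑ n, ∑ k ∈ Finset.Ici j, (A n k : ℂ) * ξ n)
              - Complex.I * ∑ k ∈ Finset.Ici j, (γ k : ℂ)))

/-- The point of the product of the lines `Im ξ_n = -w_n ω_n` with real parts `x`. -/
def contourPoint {N : ℕ} (w om : Fin N → ℝ) (x : Fin N → ℝ) : Fin N → ℂ :=
  fun n ↦ (x n : ℂ) - Complex.I * w n * om n

/-- The right-hand side of the pricing formula, for the current stock price `s`. -/
def pricingFormula {N M : ℕ} (ψ : ℂ → ℂ) (r : ℝ) (T : Fin (M + 1) → ℝ≥0) (γ : Fin M → ℝ)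
    (K w om : Fin N → ℝ) (A : Matrix (Fin N) (Fin M) ℝ) (s : ℝ) : ℂ :=
  Complex.exp (-r * ((T (Fin.last M) : ℝ) - (T 0 : ℝ))) / (2 * Real.pi * Complex.I) ^ N
    * ((s ^ (∑ k, γ k) : ℝ) : ℂ) * (∏ n, (w n : ℂ))
    * ∫ x : Fin N → ℝ, pricingIntegrand ψ T γ K A s (contourPoint w om x)

end LevyPricing

end

/-!
Write the payoff in terms of the increments `Y j = X (T j) - X (T (j-1))`, which are independent.
Each exercise condition becomes `0 ≤ w n * V n`, with `V n = ∑ B n j Y j + c n` and `B n j` the tail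
sums of the rows of `A`. Multiplied by the weight `exp (∑ g Y + ∑ ω w V)`, the damped indicator
`∏ exp (-ω w V) 1(0 ≤ w V)` of an orthant gives the payoff back. The Fourier transform of the damped
indicator is `∏ w / (i ξ)` on the contour `Im ξ n = -w n ω n`, and the weighted Fourier transform of
`V` is the product of the exponentials of `ψ`; Parseval's identity is then the pricing formula.

Four points carry the argument.

* The characteristic function of an increment is known on the real line only. Its holomorphic
  extension to the strip is bounded, so a Gaussian regularization and a contour shift bound
  `E[exp (-ηY)]`, and the identity theorem extends the formula to the strip
  (`integrable_exp_mul_of_strip`, `integral_cexp_of_strip`).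
* The integrand is absolutely integrable although the exponential need not decay in all directions
  when the rows of `A` are dependent. No row vanishes, so for each coordinate there is decay in some
  linear form that involves it; trading the largest of the factors `1 / |ξ n|` against the other
  ones then gives an integrable bound (`integrable_of_le_prod_inv`).
* The indicator is discontinuous, so that its Fourier transform is not integrable. Parseval's
  identity still holds, by Fourier inversion at one point for the convolution with the law of `V`
  (`integral_mul_comp_eq_integral_fourier`). The inversion needs the variables `V n` to have no atom
  at `0`, which follows from their integrable characteristic functions (`measure_sum_eq_zero`).
* The current log-price is independent of the later increments, so the conditional expectation is
  the expectation over these increments with the current log-price held fixed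
  (`condExp_comp_of_indepFun`).
-/

namespace LevyPricing

/-! ### Exponential moments from a holomorphic characteristic function -/

/-- Cauchy's theorem in the form of a shift of the line of integration from `Im z = 0` to
`Im z = η`, under a bound `u` that vanishes at both ends of the strip. -/
lemma integral_horizontal_shift {G : ℂ → ℂ} {η : ℝ} {u : ℝ → ℝ}
    (hG : DifferentiableOn ℂ G {z | z.im ∈ Set.uIcc 0 η})
    (hu_top : Tendsto u atTop (𝓝 0)) (hu_bot : Tendsto u atBot (𝓝 0))
    (hbd : ∀ x : ℝ, ∀ y ∈ Set.uIcc 0 η, ‖G (x + y * Complex.I)‖ ≤ u x)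
    (h0 : Integrable fun x : ℝ ↦ G x) (h1 : Integrable fun x : ℝ ↦ G (x + η * Complex.I)) :
    ∫ x : ℝ, G x = ∫ x : ℝ, G (x + η * Complex.I) := by
  have hrect : ∀ R : ℝ, (∫ x : ℝ in (-R)..R, G x) - (∫ x : ℝ in (-R)..R, G (x + η * Complex.I))
      = -(Complex.I • ∫ y : ℝ in (0 : ℝ)..η, G (R + y * Complex.I))
        + Complex.I • ∫ y : ℝ in (0 : ℝ)..η, G ((-R : ℝ) + y * Complex.I) := by
    intro R
    have h := Complex.integral_boundary_rect_eq_zero_of_differentiableOn G ((-R : ℝ) : ℂ)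
      (R + η * Complex.I) (hG.mono fun z hz ↦ by simpa using hz.2)
    simp only [Complex.add_re, Complex.ofReal_re, Complex.mul_re, Complex.I_re, mul_zero,
      Complex.ofReal_im, Complex.I_im, mul_one, sub_self, add_zero, Complex.add_im,
      Complex.mul_im, zero_add, Complex.ofReal_zero, zero_mul] at h
    linear_combination h
  have hside : ∀ l : Filter ℝ, Tendsto u l (𝓝 0) →
      Tendsto (fun R : ℝ ↦ ∫ y : ℝ in (0 : ℝ)..η, G (R + y * Complex.I)) l (𝓝 0) := by
    intro l hl
    refine squeeze_zero_norm (a := fun R ↦ u R * |η - 0|) (fun R ↦ ?_)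
      (by simpa using hl.mul_const |η - 0|)
    exact intervalIntegral.norm_integral_le_of_norm_le_const
      fun y hy ↦ hbd R y (Set.uIoc_subset_uIcc hy)
  have hlim := ((intervalIntegral_tendsto_integral h0 tendsto_neg_atTop_atBot tendsto_id).sub
    (intervalIntegral_tendsto_integral h1 tendsto_neg_atTop_atBot tendsto_id))
  have hlim0 := (((hside _ hu_top).const_smul Complex.I).neg).add
    (((hside _ hu_bot).comp tendsto_neg_atTop_atBot).const_smul Complex.I)
  have heq := tendsto_nhds_unique hlim (hlim0.congr fun R ↦ (hrect R).symm)
  simpa [sub_eq_zero] using heq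

lemma differentiableOn_gaussian_mul {F : ℂ → ℂ} {s : Set ℂ} (hF : DifferentiableOn ℂ F s)
    (b a : ℂ) : DifferentiableOn ℂ (fun z ↦ Complex.exp (-b * (z - a) ^ 2) * F z) s := by
  have : Differentiable ℂ fun z : ℂ ↦ Complex.exp (-b * (z - a) ^ 2) := by fun_prop
  exact this.differentiableOn.mul hF

lemma norm_gaussian_shift (b η x y : ℝ) :
    ‖Complex.exp (-(b : ℂ) * ((x + y * Complex.I) - η * Complex.I) ^ 2)‖
      = Real.exp (b * (y - η) ^ 2) * Real.exp (-b * x ^ 2) := by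
  rw [Complex.norm_exp, ← Real.exp_add]
  congr 1
  simp [pow_two]
  ring

/-- A Gaussian weight centred at `iη` on the real line may be recentred at `0`, at the cost of
evaluating the bounded holomorphic function on the line `Im z = η`. -/
lemma integral_gaussian_mul_shift {F : ℂ → ℂ} {lm lp D b η : ℝ} (hlm : lm < 0) (hlp : 0 < lp)
    (hF : DifferentiableOn ℂ F (openStrip lm lp)) (hD : ∀ z ∈ openStrip lm lp, ‖F z‖ ≤ D)
    (hb : 0 < b) (hη : η ∈ Set.Ioo lm lp) :
    ∫ x : ℝ, Complex.exp (-(b : ℂ) * ((x : ℂ) - η * Complex.I) ^ 2) * F x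
      = ∫ x : ℝ, Complex.exp (-(b : ℂ) * (x : ℂ) ^ 2) * F (x + η * Complex.I) := by
  have hsub : ∀ y ∈ Set.uIcc 0 η, y ∈ Set.Ioo lm lp := fun y hy ↦
    Set.OrdConnected.uIcc_subset Set.ordConnected_Ioo ⟨hlm, hlp⟩ hη hy
  have hD0 : 0 ≤ D := (norm_nonneg _).trans (hD 0 (by simp [openStrip, hlm, hlp]))
  set G : ℂ → ℂ := fun z ↦ Complex.exp (-(b : ℂ) * (z - η * Complex.I) ^ 2) * F z with hGdef
  have hGd : DifferentiableOn ℂ G (openStrip lm lp) := differentiableOn_gaussian_mul hF _ _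
  have hbd : ∀ x : ℝ, ∀ y ∈ Set.uIcc 0 η, ‖G (x + y * Complex.I)‖
      ≤ Real.exp (b * η ^ 2) * D * Real.exp (-b * x ^ 2) := by
    intro x y hy
    have hy2 : (y - η) ^ 2 ≤ η ^ 2 := by
      rcases Set.mem_uIcc.1 hy with h | h <;> nlinarith
    rw [hGdef]
    simp only [norm_mul]
    rw [norm_gaussian_shift]
    have h1 : Real.exp (b * (y - η) ^ 2) ≤ Real.exp (b * η ^ 2) := by gcongr
    have h2 : ‖F (x + y * Complex.I)‖ ≤ D := hD _ (by simpa [openStrip] using hsub y hy)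
    calc _ ≤ Real.exp (b * η ^ 2) * Real.exp (-b * x ^ 2) * D := by gcongr
      _ = _ := by ring
  have hgauss : Integrable fun x : ℝ ↦ Real.exp (b * η ^ 2) * D * Real.exp (-b * x ^ 2) :=
    (integrable_exp_neg_mul_sq hb).const_mul _
  have hint : ∀ y ∈ Set.uIcc 0 η, Integrable fun x : ℝ ↦ G (x + y * Complex.I) := by
    intro y hy
    refine hgauss.mono' (Continuous.aestronglyMeasurable ?_) (ae_of_all _ fun x ↦ hbd x y hy)
    exact hGd.continuousOn.comp_continuous (by fun_prop)
      fun x ↦ by simpa [openStrip] using hsub y hy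
  have hsq : Tendsto (fun x : ℝ ↦ b * x ^ 2) (cocompact ℝ) atTop := by
    have h := (tendsto_pow_atTop two_ne_zero).comp (tendsto_norm_cocompact_atTop (E := ℝ))
    exact (h.const_mul_atTop hb).congr fun x ↦ by simp
  have hu : Tendsto (fun x : ℝ ↦ Real.exp (b * η ^ 2) * D * Real.exp (-b * x ^ 2))
      (cocompact ℝ) (𝓝 0) := by
    have h := (Real.tendsto_exp_neg_atTop_nhds_zero.comp hsq).const_mul (Real.exp (b * η ^ 2) * D)
    simpa [Function.comp_def] using h
  have key := integral_horizontal_shift (G := G) (η := η)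
    (hGd.mono fun z hz ↦ hsub _ hz)
    (hu.mono_left atTop_le_cocompact) (hu.mono_left atBot_le_cocompact) hbd
    (by simpa using hint 0 (by simp)) (hint η (by simp))
  simpa [hGdef] using key

/-- Fubini for a Gaussian weight centred at `iη`: it turns the characteristic function into the
expectation of `exp (-ηY)`, damped by the Gaussian factor `exp (-Y² / 4b)`. -/
lemma integral_gaussian_mul_charFun {Ω : Type*} [MeasurableSpace Ω] {Q : Measure Ω}
    [IsProbabilityMeasure Q] {Y : Ω → ℝ} (hY : Measurable Y) {F : ℂ → ℂ}
    (hF : ∀ x : ℝ, ∫ ω, Complex.exp (Complex.I * x * Y ω) ∂Q = F x) {b : ℝ} (hb : 0 < b) (η : ℝ) :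
    ∫ x : ℝ, Complex.exp (-(b : ℂ) * ((x : ℂ) - η * Complex.I) ^ 2) * F x
      = (Real.pi / b : ℂ) ^ (1 / 2 : ℂ) *
        ∫ ω, Complex.exp (-(Y ω : ℂ) ^ 2 / (4 * b) - η * Y ω) ∂Q := by
  have hbc : (b : ℂ) ≠ 0 := by exact_mod_cast hb.ne'
  simp_rw [← hF, ← integral_const_mul]
  rw [integral_integral_swap]
  · refine integral_congr_ae (ae_of_all _ fun ω ↦ ?_)
    have h := fourierIntegral_gaussian (b := b) (by simpa using hb) (Y ω + 2 * b * η)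
    simp only
    have h2 : ∀ x : ℝ, Complex.exp (-(b : ℂ) * ((x : ℂ) - η * Complex.I) ^ 2)
          * Complex.exp (Complex.I * x * Y ω)
        = Complex.exp (b * η ^ 2) * (Complex.exp (Complex.I * (Y ω + 2 * b * η) * x)
          * Complex.exp (-b * (x : ℂ) ^ 2)) := by
      intro x
      rw [← Complex.exp_add, ← Complex.exp_add, ← Complex.exp_add]
      congr 1
      linear_combination (-b * η ^ 2 : ℂ) * Complex.I_sq
    simp_rw [h2]
    rw [integral_const_mul, h, mul_left_comm, ← Complex.exp_add]
    congr 2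
    field_simp
    ring
  · have hg : Integrable fun x : ℝ ↦
        Complex.exp (-(b : ℂ) * ((x : ℂ) - η * Complex.I) ^ 2) := by
      refine ((integrable_exp_neg_mul_sq hb).const_mul (Real.exp (b * η ^ 2))).mono'
        (Continuous.aestronglyMeasurable (by fun_prop)) (ae_of_all _ fun x ↦ ?_)
      simpa using (norm_gaussian_shift b η x 0).le
    have hprod := hg.mul_prod (integrable_const (μ := Q) (1 : ℂ))
    refine hprod.mono (Measurable.aestronglyMeasurable (by fun_prop)) (ae_of_all _ fun p ↦ ?_)
    have : ‖Complex.exp (Complex.I * p.1 * Y p.2)‖ = 1 := by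
      rw [mul_assoc, mul_comm, ← Complex.ofReal_mul, Complex.norm_exp_ofReal_mul_I]
    simp only [Function.uncurry, norm_mul, this, mul_one]
    exact le_rfl

/-- A bound for the holomorphic extension of the characteristic function bounds the exponential
moments: it bounds them with a Gaussian damping, uniformly in its width, and the damping is removed
by Fatou's lemma. -/
lemma lintegral_exp_neg_mul_le {Ω : Type*} [MeasurableSpace Ω] {Q : Measure Ω}
    [IsProbabilityMeasure Q] {Y : Ω → ℝ} (hY : Measurable Y) {F : ℂ → ℂ} {lm lp D : ℝ}
    (hlm : lm < 0) (hlp : 0 < lp)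
    (hF : DifferentiableOn ℂ F (openStrip lm lp)) (hD : ∀ z ∈ openStrip lm lp, ‖F z‖ ≤ D)
    (hYF : ∀ x : ℝ, ∫ ω, Complex.exp (Complex.I * x * Y ω) ∂Q = F x)
    {η : ℝ} (hη : η ∈ Set.Ioo lm lp) :
    ∫⁻ ω, ENNReal.ofReal (Real.exp (-η * Y ω)) ∂Q ≤ ENNReal.ofReal D := by
  have hD0 : 0 ≤ D := (norm_nonneg _).trans (hD 0 (by simp [openStrip, hlm, hlp]))
  have hdamped : ∀ b : ℝ, 0 < b →
      ∫⁻ ω, ENNReal.ofReal (Real.exp (-(Y ω) ^ 2 / (4 * b) - η * Y ω)) ∂Q ≤ ENNReal.ofReal D := by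
    intro b hb
    have hpos : 0 < (Real.pi / b) ^ (1 / 2 : ℝ) := by positivity
    have hbdd : ∀ x : ℝ, -x ^ 2 / (4 * b) - η * x ≤ b * η ^ 2 := by
      intro x
      have : b * η ^ 2 - (-x ^ 2 / (4 * b) - η * x) = (x + 2 * b * η) ^ 2 / (4 * b) := by
        field_simp; ring
      have h2 : 0 ≤ (x + 2 * b * η) ^ 2 / (4 * b) := by positivity
      linarith
    have hint : Integrable (fun ω ↦ Real.exp (-(Y ω) ^ 2 / (4 * b) - η * Y ω)) Q := by
      refine (integrable_const (Real.exp (b * η ^ 2))).mono'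
        (Measurable.aestronglyMeasurable (by fun_prop)) (ae_of_all _ fun ω ↦ ?_)
      rw [Real.norm_of_nonneg (Real.exp_pos _).le]
      exact Real.exp_le_exp.2 (hbdd _)
    have h1 := integral_gaussian_mul_charFun hY hYF hb η
    rw [integral_gaussian_mul_shift hlm hlp hF hD hb hη] at h1
    have h2 : ∫ ω, Complex.exp (-(Y ω : ℂ) ^ 2 / (4 * b) - η * Y ω) ∂Q
        = ((∫ ω, Real.exp (-(Y ω) ^ 2 / (4 * b) - η * Y ω) ∂Q : ℝ) : ℂ) := by
      rw [← integral_complex_ofReal]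
      push_cast
      rfl
    have h3 : (Real.pi / b : ℂ) ^ (1 / 2 : ℂ) = (((Real.pi / b) ^ (1 / 2 : ℝ) : ℝ) : ℂ) := by
      rw [Complex.ofReal_cpow (by positivity)]
      push_cast
      rfl
    have h4 : ‖∫ x : ℝ, Complex.exp (-(b : ℂ) * (x : ℂ) ^ 2) * F (x + η * Complex.I)‖
        ≤ (Real.pi / b) ^ (1 / 2 : ℝ) * D := by
      have h5 : ∀ x : ℝ, ‖Complex.exp (-(b : ℂ) * (x : ℂ) ^ 2) * F (x + η * Complex.I)‖
          ≤ Real.exp (-b * x ^ 2) * D := by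
        intro x
        rw [norm_mul, norm_cexp_neg_mul_sq]
        gcongr
        · simp
        · exact hD _ (by simpa [openStrip] using hη)
      refine (norm_integral_le_of_norm_le ((integrable_exp_neg_mul_sq hb).mul_const D)
        (ae_of_all _ h5)).trans (le_of_eq ?_)
      rw [integral_mul_const, integral_gaussian, Real.sqrt_eq_rpow]
    rw [h1, h2, h3, norm_mul, Complex.norm_real, Complex.norm_real,
      Real.norm_of_nonneg hpos.le, Real.norm_of_nonneg (integral_nonneg fun _ ↦ (Real.exp_pos _).le)]
      at h4
    rw [← ofReal_integral_eq_lintegral_ofReal hint (ae_of_all _ fun _ ↦ (Real.exp_pos _).le)]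
    exact ENNReal.ofReal_le_ofReal (le_of_mul_le_mul_left h4 hpos)
  have hlim : ∀ ω, Tendsto (fun n : ℕ ↦ ENNReal.ofReal
      (Real.exp (-(Y ω) ^ 2 / (4 * ((n : ℝ) + 1)) - η * Y ω))) atTop
      (𝓝 (ENNReal.ofReal (Real.exp (-η * Y ω)))) := by
    intro ω
    refine ENNReal.tendsto_ofReal ((Real.continuous_exp.tendsto _).comp ?_)
    have h := (tendsto_one_div_add_atTop_nhds_zero_nat (𝕜 := ℝ)).const_mul (-(Y ω) ^ 2 / 4)
    have h' := h.sub_const (η * Y ω)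
    simp only [mul_zero, zero_sub] at h'
    rw [neg_mul]
    refine h'.congr fun n ↦ ?_
    field_simp
  calc ∫⁻ ω, ENNReal.ofReal (Real.exp (-η * Y ω)) ∂Q
      = ∫⁻ ω, liminf (fun n : ℕ ↦ ENNReal.ofReal
          (Real.exp (-(Y ω) ^ 2 / (4 * ((n : ℝ) + 1)) - η * Y ω))) atTop ∂Q :=
        lintegral_congr fun ω ↦ (hlim ω).liminf_eq.symm
    _ ≤ liminf (fun n : ℕ ↦ ∫⁻ ω, ENNReal.ofReal
          (Real.exp (-(Y ω) ^ 2 / (4 * ((n : ℝ) + 1)) - η * Y ω)) ∂Q) atTop :=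
        lintegral_liminf_le fun n ↦ by fun_prop
    _ ≤ liminf (fun _ : ℕ ↦ ENNReal.ofReal D) atTop :=
        liminf_le_liminf (Eventually.of_forall fun n ↦ hdamped _ (by positivity))
    _ = ENNReal.ofReal D := liminf_const _

/-- If the characteristic function of `Y` extends to a bounded holomorphic function on a strip
around the real axis, then `Y` has the corresponding exponential moments. -/
lemma integrable_exp_mul_of_strip {Ω : Type*} [MeasurableSpace Ω] {Q : Measure Ω}
    [IsProbabilityMeasure Q] {Y : Ω → ℝ} (hY : Measurable Y) {F : ℂ → ℂ} {lm lp D : ℝ}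
    (hlm : lm < 0) (hlp : 0 < lp)
    (hF : DifferentiableOn ℂ F (openStrip lm lp)) (hD : ∀ z ∈ openStrip lm lp, ‖F z‖ ≤ D)
    (hYF : ∀ x : ℝ, ∫ ω, Complex.exp (Complex.I * x * Y ω) ∂Q = F x)
    {θ : ℝ} (hθ : -θ ∈ Set.Ioo lm lp) :
    Integrable (fun ω ↦ Real.exp (θ * Y ω)) Q := by
  refine ⟨Measurable.aestronglyMeasurable (by fun_prop), ?_⟩
  rw [hasFiniteIntegral_iff_ofReal (ae_of_all _ fun _ ↦ (Real.exp_pos _).le)]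
  have h := lintegral_exp_neg_mul_le hY hlm hlp hF hD hYF hθ
  simp only [neg_neg] at h
  exact h.trans_lt ENNReal.ofReal_lt_top

/-- By the identity theorem, a holomorphic extension of the characteristic function to a strip is
given there by the expectation of `exp (iζY)`. -/
lemma integral_cexp_of_strip {Ω : Type*} [MeasurableSpace Ω] {Q : Measure Ω}
    [IsProbabilityMeasure Q] {Y : Ω → ℝ} (hY : Measurable Y) {F : ℂ → ℂ} {lm lp D : ℝ}
    (hlm : lm < 0) (hlp : 0 < lp)
    (hF : DifferentiableOn ℂ F (openStrip lm lp)) (hD : ∀ z ∈ openStrip lm lp, ‖F z‖ ≤ D)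
    (hYF : ∀ x : ℝ, ∫ ω, Complex.exp (Complex.I * x * Y ω) ∂Q = F x)
    {ζ : ℂ} (hζ : ζ ∈ openStrip lm lp) :
    ∫ ω, Complex.exp (Complex.I * ζ * Y ω) ∂Q = F ζ := by
  have hopen : IsOpen (openStrip lm lp) := isOpen_Ioo.preimage Complex.continuous_im
  have hpre : IsPreconnected (openStrip lm lp) :=
    ((convex_Ioo lm lp).is_linear_preimage Complex.imLm.isLinear).isPreconnected
  have hset : Set.Ioo (-lp) (-lm) ⊆ interior (integrableExpSet Y Q) := by
    refine interior_maximal (fun θ hθ ↦ ?_) isOpen_Ioo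
    exact integrable_exp_mul_of_strip hY hlm hlp hF hD hYF
      ⟨by linarith [hθ.2], by linarith [hθ.1]⟩
  have hmgf : AnalyticOnNhd ℂ (fun z ↦ complexMGF Y Q (Complex.I * z)) (openStrip lm lp) := by
    refine DifferentiableOn.analyticOnNhd ?_ hopen
    refine differentiableOn_complexMGF.comp (by fun_prop) fun z hz ↦ hset ?_
    simp only [openStrip, Set.mem_ofPred_eq, Set.mem_Ioo] at hz
    simp only [Complex.mul_re, Complex.I_re, zero_mul, Complex.I_im, one_mul, zero_sub,
      Set.mem_Ioo]
    exact ⟨by linarith, by linarith⟩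
  have hreal : ∃ᶠ z in 𝓝[≠] (0 : ℂ), complexMGF Y Q (Complex.I * z) = F z := by
    have h : Tendsto (fun x : ℝ ↦ (x : ℂ)) (𝓝[≠] 0) (𝓝[≠] (0 : ℂ)) := by
      refine tendsto_nhdsWithin_iff.2 ⟨?_, ?_⟩
      · exact (Complex.continuous_ofReal.tendsto' 0 0 (by simp)).mono_left nhdsWithin_le_nhds
      · filter_upwards [self_mem_nhdsWithin] with x hx
        simpa using hx
    refine h.frequently (Eventually.frequently (Eventually.of_forall fun x ↦ ?_))
    rw [← hYF]
    rfl
  exact hmgf.eqOn_of_preconnected_of_frequently_eq (hF.analyticOnNhd hopen) hpre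
    (by simp [openStrip, hlm, hlp]) hreal hζ

/-- A random variable with integrable characteristic function has no atoms: the mass at `a` is at
most the expectation of `exp (-(Y - a)² / 4b)`, which by Fourier transform is of order `√b`. -/
lemma measure_eq_zero_of_integrable_charFun {Ω : Type*} [MeasurableSpace Ω] {Q : Measure Ω}
    [IsProbabilityMeasure Q] {Y : Ω → ℝ} (hY : Measurable Y) {F : ℝ → ℂ} (hF : Integrable F)
    (hYF : ∀ x : ℝ, ∫ ω, Complex.exp (Complex.I * x * Y ω) ∂Q = F x) (a : ℝ) :
    Q {ω | Y ω = a} = 0 := by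
  set C : ℝ := ∫ x, ‖F x‖
  have hbound : ∀ b : ℝ, 0 < b → (Real.pi / b) ^ (1 / 2 : ℝ) * Q.real {ω | Y ω = a} ≤ C := by
    intro b hb
    have hpos : 0 < (Real.pi / b) ^ (1 / 2 : ℝ) := by positivity
    have hYa : Measurable fun ω ↦ Y ω - a := hY.sub_const a
    have h1 := integral_gaussian_mul_charFun (Q := Q) hYa
      (F := fun z ↦ Complex.exp (-Complex.I * z * a) * F z.re) (fun x ↦ by
        simp only [Complex.ofReal_re, ← hYF, ← integral_const_mul, ← Complex.exp_add]
        congr 1 with ω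
        push_cast
        congr 1
        ring) hb 0
    have h2 : ∫ ω, Complex.exp (-((Y ω - a : ℝ) : ℂ) ^ 2 / (4 * b)
          - ((0 : ℝ) : ℂ) * (Y ω - a : ℝ)) ∂Q
        = ((∫ ω, Real.exp (-(Y ω - a) ^ 2 / (4 * b)) ∂Q : ℝ) : ℂ) := by
      rw [← integral_complex_ofReal]
      push_cast
      simp
    have h3 : (Real.pi / b : ℂ) ^ (1 / 2 : ℂ) = (((Real.pi / b) ^ (1 / 2 : ℝ) : ℝ) : ℂ) := by
      rw [Complex.ofReal_cpow (by positivity)]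
      push_cast
      rfl
    have h4 := congrArg norm h1
    rw [h2, h3, norm_mul, Complex.norm_real, Complex.norm_real, Real.norm_of_nonneg hpos.le,
      Real.norm_of_nonneg (integral_nonneg fun _ ↦ (Real.exp_pos _).le)] at h4
    have hint : Integrable (fun ω ↦ Real.exp (-(Y ω - a) ^ 2 / (4 * b))) Q := by
      refine (integrable_const (1 : ℝ)).mono'
        (Measurable.aestronglyMeasurable (by fun_prop)) (ae_of_all _ fun ω ↦ ?_)
      rw [Real.norm_of_nonneg (Real.exp_pos _).le, Real.exp_le_one_iff]
      exact div_nonpos_of_nonpos_of_nonneg (by nlinarith [sq_nonneg (Y ω - a)]) (by positivity)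
    have hset : MeasurableSet {ω | Y ω = a} := measurableSet_eq_fun hY measurable_const
    have h5 : Q.real {ω | Y ω = a} ≤ ∫ ω, Real.exp (-(Y ω - a) ^ 2 / (4 * b)) ∂Q := by
      rw [← integral_indicator_one hset]
      refine integral_mono ((integrable_const (1 : ℝ)).indicator hset) hint fun ω ↦ ?_
      by_cases h : Y ω = a
      · simp [h]
      · simpa [Set.indicator, h] using (Real.exp_pos _).le
    refine (mul_le_mul_of_nonneg_left h5 hpos.le).trans (h4.symm.le.trans ?_)
    refine norm_integral_le_of_norm_le hF.norm (ae_of_all _ fun x ↦ ?_)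
    have h6 : ‖Complex.exp (-(b : ℂ) * ((x : ℂ) - ((0 : ℝ) : ℂ) * Complex.I) ^ 2)‖ ≤ 1 := by
      have := norm_gaussian_shift b 0 x 0
      simp only [Complex.ofReal_zero, zero_mul, add_zero, sub_zero] at this ⊢
      rw [this]
      simp only [ne_eq, OfNat.ofNat_ne_zero, not_false_eq_true, zero_pow, mul_zero, Real.exp_zero,
        one_mul, Real.exp_le_one_iff]
      nlinarith [sq_nonneg x]
    have h7 : ‖Complex.exp (-Complex.I * x * a)‖ = 1 := by
      rw [show -Complex.I * x * a = ((-(x * a) : ℝ) : ℂ) * Complex.I by push_cast; ring,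
        Complex.norm_exp_ofReal_mul_I]
    rw [norm_mul, norm_mul, h7, one_mul, Complex.ofReal_re]
    exact mul_le_of_le_one_left (norm_nonneg _) h6
  by_contra hne
  have hq : 0 < Q.real {ω | Y ω = a} :=
    ENNReal.toReal_pos hne (measure_ne_top _ _)
  set q := Q.real {ω | Y ω = a}
  have hC : 0 ≤ C := integral_nonneg fun _ ↦ norm_nonneg _
  -- the width `b` makes the left-hand side of `hbound` equal to `C + 1`
  have hs : 0 < (C + 1) / q := by positivity
  have h := hbound (Real.pi / ((C + 1) / q) ^ 2) (by positivity)
  rw [div_div_cancel₀ Real.pi_ne_zero, ← Real.sqrt_eq_rpow, Real.sqrt_sq hs.le,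
    div_mul_cancel₀ _ hq.ne'] at h
  linarith

/-! ### Absolute convergence of the contour integral -/

/-- A product of integrable functions of single coordinates stays integrable when one coordinate
`x n` is replaced by a linear form that involves it. -/
lemma integrable_prod_update_linear {ι : Type*} [Fintype ι] [DecidableEq ι] {f : ι → ℝ → ℝ}
    (hf : ∀ m, Integrable (f m)) (n : ι) {l : ι → ℝ} (hl : l n ≠ 0) :
    Integrable fun x : ι → ℝ ↦ ∏ m, f m (Function.update x n (∑ i, l i * x i) m) := by
  let L : (ι → ℝ) →ₗ[ℝ] (ι → ℝ) := LinearMap.pi fun m ↦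
    if m = n then ∑ i, l i • LinearMap.proj i else LinearMap.proj m
  have hL : ∀ x, L x = Function.update x n (∑ i, l i * x i) := by
    intro x
    ext m
    by_cases h : m = n
    · subst h
      simp [L]
    · simp [L, h]
  have hker : LinearMap.ker L = ⊥ := by
    refine (LinearMap.ker_eq_bot').2 fun x hx ↦ ?_
    rw [hL] at hx
    have hne : ∀ m, m ≠ n → x m = 0 := fun m hm ↦ by simpa [hm] using congrFun hx m
    have hn : l n * x n = 0 := by
      have h := congrFun hx n
      rw [Function.update_self, Finset.sum_eq_single n (fun m _ hm ↦ by rw [hne m hm, mul_zero])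
        (by simp)] at h
      exact h
    ext m
    by_cases h : m = n
    · subst h
      exact (mul_eq_zero.1 hn).resolve_left hl
    · exact hne m h
  have hdet : LinearMap.det L ≠ 0 := fun h ↦
    (LinearMap.bot_lt_ker_of_det_eq_zero h).ne' hker
  have hprod : Integrable (fun y : ι → ℝ ↦ ∏ m, f m (y m)) := Integrable.fintype_prod hf
  have hmap : Integrable (fun y : ι → ℝ ↦ ∏ m, f m (y m)) (Measure.map L volume) := by
    rw [Measure.map_linearMap_addHaar_eq_smul_addHaar volume hdet]
    exact hprod.smul_measure ENNReal.ofReal_ne_top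
  have hcomp := hmap.comp_measurable (L.continuous_of_finiteDimensional).measurable
  simpa only [Function.comp_def, hL] using hcomp

/-- Power counting: the largest factor of `∏ (1 + |x m|)⁻¹` may be traded for a higher power of
the others, so that these are integrable. -/
lemma prod_inv_le_prod_erase {ι : Type*} [Fintype ι] [DecidableEq ι] (x : ι → ℝ) (n : ι)
    (hn : ∀ m, |x m| ≤ |x n|) :
    ∏ m, (1 + ‖x m‖)⁻¹
      ≤ ∏ m ∈ Finset.univ.erase n, (1 + ‖x m‖) ^ (-(1 + (Fintype.card ι : ℝ)⁻¹)) := by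
  have hcard : (0 : ℝ) < Fintype.card ι := by exact_mod_cast Fintype.card_pos_iff.2 ⟨n⟩
  have hone : ∀ m, 1 ≤ 1 + ‖x m‖ := fun m ↦ by linarith [norm_nonneg (x m)]
  have hpos : ∀ m, 0 < 1 + ‖x m‖ := fun m ↦ one_pos.trans_le (hone m)
  have h1 : (1 + ‖x n‖)⁻¹
      ≤ ∏ m ∈ Finset.univ.erase n, (1 + ‖x m‖) ^ (-(Fintype.card ι : ℝ)⁻¹) := by
    calc (1 + ‖x n‖)⁻¹ = ∏ _m : ι, (1 + ‖x n‖) ^ (-(Fintype.card ι : ℝ)⁻¹) := by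
          rw [Finset.prod_const, Finset.card_univ, ← Real.rpow_natCast, ← Real.rpow_mul (hpos n).le,
            neg_mul, inv_mul_cancel₀ hcard.ne', Real.rpow_neg_one]
      _ ≤ ∏ m, (1 + ‖x m‖) ^ (-(Fintype.card ι : ℝ)⁻¹) := by
          refine Finset.prod_le_prod (fun _ _ ↦ (Real.rpow_pos_of_pos (hpos n) _).le)
            fun m _ ↦ ?_
          exact Real.rpow_le_rpow_of_nonpos (hpos m) (by simpa using hn m)
            (by simp only [Left.neg_nonpos_iff]; positivity)
      _ = (1 + ‖x n‖) ^ (-(Fintype.card ι : ℝ)⁻¹)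
            * ∏ m ∈ Finset.univ.erase n, (1 + ‖x m‖) ^ (-(Fintype.card ι : ℝ)⁻¹) :=
          (Finset.mul_prod_erase _ _ (Finset.mem_univ n)).symm
      _ ≤ _ := by
          refine mul_le_of_le_one_left
            (Finset.prod_nonneg fun m _ ↦ (Real.rpow_pos_of_pos (hpos m) _).le) ?_
          exact Real.rpow_le_one_of_one_le_of_nonpos (hone n)
            (by simp only [Left.neg_nonpos_iff]; positivity)
  rw [← Finset.mul_prod_erase _ _ (Finset.mem_univ n)]
  calc _ ≤ (∏ m ∈ Finset.univ.erase n, (1 + ‖x m‖) ^ (-(Fintype.card ι : ℝ)⁻¹))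
        * ∏ m ∈ Finset.univ.erase n, (1 + ‖x m‖)⁻¹ := by
        refine mul_le_mul_of_nonneg_right h1 (Finset.prod_nonneg fun m _ ↦ ?_)
        exact (inv_pos.2 (hpos m)).le
    _ = _ := by
        rw [← Finset.prod_mul_distrib]
        refine Finset.prod_congr rfl fun m _ ↦ ?_
        rw [← Real.rpow_neg_one (1 + ‖x m‖), ← Real.rpow_add (hpos m)]
        congr 1
        ring

/-- A function on `ℝ^ι` is integrable if it is dominated by `∏ (1 + |x m|)⁻¹` and, for every
coordinate `n`, has in addition quadratic decay in a linear form that involves `x n`. -/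
lemma integrable_of_le_prod_inv {ι : Type*} [Fintype ι] {Φ : (ι → ℝ) → ℂ}
    (hΦ : AEStronglyMeasurable Φ) {C : ℝ} (hC : 0 ≤ C) {l : ι → ι → ℝ} (hl : ∀ n, l n n ≠ 0)
    (hbound : ∀ x, ‖Φ x‖ ≤ C * ∏ m, (1 + ‖x m‖)⁻¹)
    (hdecay : ∀ n x, ‖Φ x‖ ≤ C * (∏ m, (1 + ‖x m‖)⁻¹)
      * (1 + ‖∑ i, l n i * x i‖) ^ (-2 : ℝ)) :
    Integrable Φ := by
  classical
  rcases isEmpty_or_nonempty ι with hι | hι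
  · refine (integrable_const C).mono' hΦ (ae_of_all _ fun x ↦ ?_)
    simpa using hbound x
  let f : ι → ι → ℝ → ℝ := fun n m t ↦
    if m = n then (1 + ‖t‖) ^ (-2 : ℝ) else (1 + ‖t‖) ^ (-(1 + (Fintype.card ι : ℝ)⁻¹))
  have hcard : (0 : ℝ) < Fintype.card ι := by exact_mod_cast Fintype.card_pos
  have hf : ∀ n m, Integrable (f n m) := by
    intro n m
    by_cases h : m = n
    · simp only [f, h, if_true]
      exact integrable_one_add_norm (by simp)
    · simp only [f, h, if_false]
      exact integrable_one_add_norm (by simpa using hcard)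
  have hf0 : ∀ n m t, 0 ≤ f n m t := by
    intro n m t
    simp only [f]
    split_ifs <;> positivity
  have hsum : Integrable fun x : ι → ℝ ↦
      C * ∑ n, ∏ m, f n m (Function.update x n (∑ i, l n i * x i) m) :=
    (integrable_finsetSum _ fun n _ ↦ integrable_prod_update_linear (hf n) n (hl n)).const_mul C
  refine hsum.mono' hΦ (ae_of_all _ fun x ↦ ?_)
  obtain ⟨n, hn⟩ := Finite.exists_max fun m ↦ |x m|
  have hsplit : ∏ m, f n m (Function.update x n (∑ i, l n i * x i) m)
      = (1 + ‖∑ i, l n i * x i‖) ^ (-2 : ℝ)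
        * ∏ m ∈ Finset.univ.erase n, (1 + ‖x m‖) ^ (-(1 + (Fintype.card ι : ℝ)⁻¹)) := by
    rw [← Finset.mul_prod_erase _ _ (Finset.mem_univ n)]
    congr 1
    · simp [f]
    · refine Finset.prod_congr rfl fun m hm ↦ ?_
      simp [f, Finset.ne_of_mem_erase hm]
  calc ‖Φ x‖ ≤ C * (∏ m, (1 + ‖x m‖)⁻¹) * (1 + ‖∑ i, l n i * x i‖) ^ (-2 : ℝ) := hdecay n x
    _ ≤ C * (∏ m ∈ Finset.univ.erase n, (1 + ‖x m‖) ^ (-(1 + (Fintype.card ι : ℝ)⁻¹)))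
          * (1 + ‖∑ i, l n i * x i‖) ^ (-2 : ℝ) := by
        gcongr
        exact prod_inv_le_prod_erase x n hn
    _ = C * ∏ m, f n m (Function.update x n (∑ i, l n i * x i) m) := by
        rw [hsplit]
        ring
    _ ≤ _ := by
        refine mul_le_mul_of_nonneg_left ?_ hC
        exact Finset.single_le_sum
          (f := fun n ↦ ∏ m, f n m (Function.update x n (∑ i, l n i * x i) m))
          (fun n _ ↦ Finset.prod_nonneg fun m _ ↦ hf0 n m _) (Finset.mem_univ n)

/-! ### A Parseval identity for discontinuous test functions -/

open scoped FourierTransform RealInnerProductSpace in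
/-- Parseval's identity `∫ W · h(Z) dQ = ∫ 𝓕h(v) · (∫ W exp(2πi⟨Z, v⟩) dQ) dv`. Here `h` need not
be continuous: it is enough that `Z` almost surely avoids its discontinuities. The identity is the
Fourier inversion formula at `0` for the function `y ↦ ∫ W · h(Z + y) dQ`. -/
lemma integral_mul_comp_eq_integral_fourier {Ω V : Type*} [MeasurableSpace Ω] {Q : Measure Ω}
    [SFinite Q]
    [NormedAddCommGroup V] [InnerProductSpace ℝ V] [MeasurableSpace V] [BorelSpace V]
    [FiniteDimensional ℝ V] {W : Ω → ℂ} (hWm : Measurable W) (hW : Integrable W Q) {Z : Ω → V}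
    (hZ : Measurable Z) {h : V → ℂ} (hm : Measurable h) (hint : Integrable h) {C : ℝ}
    (hbd : ∀ z, ‖h z‖ ≤ C) (hc : ∀ᵐ ω ∂Q, ContinuousAt h (Z ω))
    (hF : Integrable fun v : V ↦
      𝓕 h v * ∫ ω, W ω * Complex.exp (↑(2 * Real.pi * ⟪Z ω, v⟫) * Complex.I) ∂Q) :
    ∫ ω, W ω * h (Z ω) ∂Q
      = ∫ v : V, 𝓕 h v * ∫ ω, W ω * Complex.exp (↑(2 * Real.pi * ⟪Z ω, v⟫) * Complex.I) ∂Q := by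
  set H : V → ℂ := fun y ↦ ∫ ω, W ω * h (Z ω + y) ∂Q with hH
  have hjm : Measurable fun p : V × Ω ↦ W p.2 * h (Z p.2 + p.1) := by fun_prop
  have hjoint : Integrable (fun p : V × Ω ↦ W p.2 * h (Z p.2 + p.1)) (volume.prod Q) := by
    rw [integrable_prod_iff' hjm.aestronglyMeasurable]
    refine ⟨ae_of_all _ fun ω ↦ (hint.comp_add_left (Z ω)).const_mul (W ω), ?_⟩
    have : ∀ ω, ∫ y, ‖W ω * h (Z ω + y)‖ = ‖W ω‖ * ∫ y, ‖h y‖ := by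
      intro ω
      simp only [norm_mul]
      rw [integral_const_mul, integral_add_left_eq_self (fun y ↦ ‖h y‖)]
    simp only [this]
    exact hW.norm.mul_const _
  have hHint : Integrable H := hjoint.integral_prod_left
  have hFH : 𝓕 H = fun v : V ↦
      𝓕 h v * ∫ ω, W ω * Complex.exp (↑(2 * Real.pi * ⟪Z ω, v⟫) * Complex.I) ∂Q := by
    ext v
    have hphase : ∀ y : V, ‖Complex.exp (↑(-2 * Real.pi * ⟪y, v⟫) * Complex.I)‖ = 1 :=
      fun y ↦ Complex.norm_exp_ofReal_mul_I _
    have hshift : ∀ ω,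
        ∫ y, Complex.exp (↑(-2 * Real.pi * ⟪y, v⟫) * Complex.I) * (W ω * h (Z ω + y))
        = 𝓕 h v * (W ω * Complex.exp (↑(2 * Real.pi * ⟪Z ω, v⟫) * Complex.I)) := by
      intro ω
      rw [Real.fourier_eq', ← integral_mul_const, ← integral_add_left_eq_self
        (fun y ↦ Complex.exp (↑(-2 * Real.pi * ⟪y, v⟫) * Complex.I) • h y * _) (Z ω)]
      refine integral_congr_ae (ae_of_all _ fun y ↦ ?_)
      simp only [inner_add_left, smul_eq_mul]
      have hexp : Complex.exp (↑(-2 * Real.pi * (⟪Z ω, v⟫ + ⟪y, v⟫)) * Complex.I)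
          * Complex.exp (↑(2 * Real.pi * ⟪Z ω, v⟫) * Complex.I)
          = Complex.exp (↑(-2 * Real.pi * ⟪y, v⟫) * Complex.I) := by
        rw [← Complex.exp_add]
        congr 1
        push_cast
        ring
      rw [← hexp]
      ring
    rw [Real.fourier_eq']
    simp only [smul_eq_mul, hH, ← integral_const_mul]
    rw [integral_integral_swap]
    · exact integral_congr_ae (ae_of_all _ hshift)
    · refine hjoint.mono (Measurable.aestronglyMeasurable ?_) (ae_of_all _ fun p ↦ ?_)
      · fun_prop
      · simp only [Function.uncurry, norm_mul, hphase, one_mul]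
        exact le_rfl
  -- dominated convergence, as translates of `h` converge at its points of continuity
  have hcont : ContinuousAt H 0 := by
    refine continuousAt_of_dominated (bound := fun ω ↦ ‖W ω‖ * C)
      (Eventually.of_forall fun y ↦ Measurable.aestronglyMeasurable (by fun_prop))
      (Eventually.of_forall fun y ↦ ae_of_all _ fun ω ↦ ?_) (hW.norm.mul_const C) ?_
    · rw [norm_mul]
      gcongr
      exact hbd _
    · filter_upwards [hc] with ω hω
      refine ContinuousAt.mul continuousAt_const ?_
      refine ContinuousAt.comp (g := h) (f := fun y ↦ Z ω + y) ?_ (by fun_prop)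
      simpa using hω
  have hinv := hHint.fourierInv_fourier_eq (by rw [hFH]; exact hF) hcont
  rw [Real.fourierInv_eq', hFH] at hinv
  simpa [hH] using hinv.symm

/-! ### The Fourier transform of a damped orthant indicator -/

/-- The exponentially damped indicator of the half-line `0 ≤ w t`, for a sign `w = ±1`. -/
noncomputable def dampedStep (w a t : ℝ) : ℂ :=
  if 0 ≤ w * t then Complex.exp (-(a * (w * t) : ℝ)) else 0

lemma measurable_dampedStep (w a : ℝ) : Measurable (dampedStep w a) :=
  Measurable.ite (measurableSet_le measurable_const (by fun_prop)) (by fun_prop) measurable_const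

lemma norm_dampedStep_le_one {w a : ℝ} (ha : 0 < a) (t : ℝ) : ‖dampedStep w a t‖ ≤ 1 := by
  rw [dampedStep]
  split_ifs with h
  · rw [Complex.norm_exp]
    have : 0 ≤ a * (w * t) := by positivity
    simpa using this
  · simp

lemma continuousAt_dampedStep {w a t : ℝ} (h : w * t ≠ 0) : ContinuousAt (dampedStep w a) t := by
  rcases lt_or_gt_of_ne h with h | h
  · refine (continuousAt_const (y := (0 : ℂ))).congr ?_
    filter_upwards [(isOpen_lt (f := fun t ↦ w * t) (by fun_prop) continuous_const).mem_nhds h]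
      with x hx
    rw [dampedStep, if_neg (not_le.2 hx)]
  · refine ContinuousAt.congr (f := fun t : ℝ ↦ Complex.exp (-(a * (w * t) : ℝ))) (by fun_prop) ?_
    filter_upwards [(isOpen_lt continuous_const (g := fun t ↦ w * t) (by fun_prop)).mem_nhds h]
      with x hx
    rw [dampedStep, if_pos (le_of_lt hx)]

lemma integrable_dampedStep {w a : ℝ} (hw : w = 1 ∨ w = -1) (ha : 0 < a) :
    Integrable (dampedStep w a) := by
  rcases hw with rfl | rfl
  · have hind : dampedStep 1 a
        = (Set.Ici 0).indicator fun t : ℝ ↦ Complex.exp (((-a : ℝ) : ℂ) * t) := by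
      ext t
      by_cases h : 0 ≤ t <;> simp [dampedStep, h]
    rw [hind, integrable_indicator_iff measurableSet_Ici, integrableOn_Ici_iff_integrableOn_Ioi]
    exact integrableOn_exp_mul_complex_Ioi (by simpa using ha) 0
  · have hind : dampedStep (-1) a
        = (Set.Iic 0).indicator fun t : ℝ ↦ Complex.exp ((a : ℂ) * t) := by
      ext t
      by_cases h : t ≤ 0 <;> simp [dampedStep, h]
    rw [hind, integrable_indicator_iff measurableSet_Iic]
    exact integrableOn_exp_mul_complex_Iic (by simpa using ha) 0

/-- The Fourier transform of the damped step: at frequency `u` it is `w / (i ξ)` with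
`ξ = u - i w a`. -/
lemma integral_dampedStep {w a : ℝ} (hw : w = 1 ∨ w = -1) (ha : 0 < a) (u : ℝ) :
    ∫ t : ℝ, Complex.exp (-(Complex.I * u * t)) * dampedStep w a t
      = w / (Complex.I * (u - Complex.I * w * a)) := by
  have hre : ∀ s : ℝ, (s - Complex.I * u : ℂ).re = s := fun s ↦ by simp
  have hne : ∀ s : ℝ, s ≠ 0 → (s - Complex.I * u : ℂ) ≠ 0 := fun s hs h ↦ hs (by
    rw [← hre s, h, Complex.zero_re])
  rcases hw with rfl | rfl
  · have hind : (fun t : ℝ ↦ Complex.exp (-(Complex.I * u * t)) * dampedStep 1 a t)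
        = (Set.Ici 0).indicator fun t : ℝ ↦ Complex.exp (((-a : ℝ) - Complex.I * u) * t) := by
      ext t
      by_cases h : 0 ≤ t
      · simp only [dampedStep, one_mul, h, if_true, Set.mem_Ici, Set.indicator_of_mem,
          ← Complex.exp_add]
        congr 1
        push_cast
        ring
      · simp [dampedStep, h]
    rw [hind, integral_indicator measurableSet_Ici, integral_Ici_eq_integral_Ioi,
      integral_exp_mul_complex_Ioi (by rw [hre]; linarith)]
    have h1 := hne (-a) (by linarith)
    have h2 : Complex.I * (u - Complex.I * (1 : ℝ) * a) = -((-a : ℝ) - Complex.I * u) := by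
      push_cast
      linear_combination (-a : ℂ) * Complex.I_sq
    rw [h2, div_neg, neg_div]
    simp only [Complex.ofReal_zero, mul_zero, Complex.exp_zero, Complex.ofReal_one]
  · have hind : (fun t : ℝ ↦ Complex.exp (-(Complex.I * u * t)) * dampedStep (-1) a t)
        = (Set.Iic 0).indicator fun t : ℝ ↦ Complex.exp ((a - Complex.I * u) * t) := by
      ext t
      by_cases h : t ≤ 0
      · have h' : 0 ≤ -1 * t := by linarith
        simp only [dampedStep, h', h, if_true, Set.mem_Iic, Set.indicator_of_mem,
          ← Complex.exp_add]
        congr 1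
        push_cast
        ring
      · have h' : ¬ 0 ≤ -1 * t := by linarith
        simp [dampedStep, h]
    rw [hind, integral_indicator measurableSet_Iic,
      integral_exp_mul_complex_Iic (by rw [hre]; exact ha)]
    have h1 := hne a ha.ne'
    have h2 : Complex.I * (u - Complex.I * (-1 : ℝ) * a) = -(a - Complex.I * u) := by
      push_cast
      linear_combination (a : ℂ) * Complex.I_sq
    rw [h2, Complex.ofReal_neg, neg_div_neg_eq]
    simp only [Complex.ofReal_zero, mul_zero, Complex.exp_zero, Complex.ofReal_one]

/-- The product of damped steps: an exponentially damped indicator of the orthant with signs `w`,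
on Euclidean space so that Fourier inversion applies. -/
noncomputable def dampedOrthant {ι : Type*} [Fintype ι] (w a : ι → ℝ)
    (z : EuclideanSpace ℝ ι) : ℂ :=
  ∏ n, dampedStep (w n) (a n) (z n)

lemma measurable_dampedOrthant {ι : Type*} [Fintype ι] (w a : ι → ℝ) :
    Measurable (dampedOrthant w a) := by
  unfold dampedOrthant
  refine Finset.measurable_prod _ fun n _ ↦ (measurable_dampedStep _ _).comp ?_
  fun_prop

lemma norm_dampedOrthant_le_one {ι : Type*} [Fintype ι] {w a : ι → ℝ} (ha : ∀ n, 0 < a n)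
    (z : EuclideanSpace ℝ ι) : ‖dampedOrthant w a z‖ ≤ 1 := by
  rw [dampedOrthant, norm_prod]
  exact Finset.prod_le_one (fun _ _ ↦ norm_nonneg _) fun n _ ↦ norm_dampedStep_le_one (ha n) _

lemma continuousAt_dampedOrthant {ι : Type*} [Fintype ι] {w a : ι → ℝ} {z : EuclideanSpace ℝ ι}
    (h : ∀ n, w n * z n ≠ 0) : ContinuousAt (dampedOrthant w a) z := by
  unfold dampedOrthant
  refine tendsto_finsetProd _ fun n _ ↦ ?_
  exact ContinuousAt.comp (g := dampedStep (w n) (a n)) (f := fun z : EuclideanSpace ℝ ι ↦ z n)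
    (continuousAt_dampedStep (h n)) (by fun_prop)

lemma integrable_dampedOrthant {ι : Type*} [Fintype ι] {w a : ι → ℝ}
    (hw : ∀ n, w n = 1 ∨ w n = -1) (ha : ∀ n, 0 < a n) : Integrable (dampedOrthant w a) := by
  have h : Integrable (fun x : ι → ℝ ↦ ∏ n, dampedStep (w n) (a n) (x n)) :=
    Integrable.fintype_prod fun n ↦ integrable_dampedStep (hw n) (ha n)
  exact (PiLp.volume_preserving_ofLp ι).integrable_comp_of_integrable h

open scoped FourierTransform RealInnerProductSpace in
lemma fourier_dampedOrthant {ι : Type*} [Fintype ι] {w a : ι → ℝ}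
    (hw : ∀ n, w n = 1 ∨ w n = -1) (ha : ∀ n, 0 < a n) (v : EuclideanSpace ℝ ι) :
    𝓕 (dampedOrthant w a) v
      = ∏ n, (w n : ℂ) / (Complex.I * ((2 * Real.pi * v n : ℝ) - Complex.I * w n * a n)) := by
  rw [Real.fourier_eq']
  have h : ∀ z : EuclideanSpace ℝ ι,
      Complex.exp (↑(-2 * Real.pi * ⟪z, v⟫) * Complex.I) • dampedOrthant w a z
      = (fun x : ι → ℝ ↦ ∏ n, (Complex.exp (-(Complex.I * (2 * Real.pi * v n : ℝ) * x n))
          * dampedStep (w n) (a n) (x n))) (WithLp.ofLp z) := by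
    intro z
    simp only [dampedOrthant, Finset.prod_mul_distrib, ← Complex.exp_sum, smul_eq_mul]
    congr 2
    rw [PiLp.inner_apply]
    push_cast
    rw [Finset.mul_sum, Finset.sum_mul]
    refine Finset.sum_congr rfl fun n _ ↦ ?_
    simp
    ring
  simp_rw [h]
  rw [(PiLp.volume_preserving_ofLp ι).integral_comp
    (MeasurableEquiv.toLp 2 (ι → ℝ)).symm.measurableEmbedding (fun x : ι → ℝ ↦
      ∏ n, (Complex.exp (-(Complex.I * (2 * Real.pi * v n : ℝ) * x n))
          * dampedStep (w n) (a n) (x n))),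
    integral_fintype_prod_volume_eq_prod
      (fun n (t : ℝ) ↦ Complex.exp (-(Complex.I * (2 * Real.pi * v n : ℝ) * t))
        * dampedStep (w n) (a n) t)]
  exact Finset.prod_congr rfl fun n _ ↦ integral_dampedStep (hw n) (ha n) _

/-! ### Linear combinations of independent variables -/

/-- `f` is a holomorphic extension of the characteristic function of `Y` to the strip
`Im ζ ∈ ]lm, lp[`, with quadratic decay in the real part. -/
structure HasStripCharFun {Ω : Type*} [MeasurableSpace Ω] (Q : Measure Ω) (Y : Ω → ℝ)
    (lm lp : ℝ) (f : ℂ → ℂ) : Prop where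
  measurable : Measurable Y
  holomorphic : DifferentiableOn ℂ f (openStrip lm lp)
  decay : ∃ D : ℝ, ∀ ζ ∈ openStrip lm lp, ‖f ζ‖ ≤ D * (1 + ‖ζ.re‖) ^ (-2 : ℝ)
  charFun_eq : ∀ x : ℝ, ∫ ω, Complex.exp (Complex.I * x * Y ω) ∂Q = f x

lemma one_add_norm_rpow_le_one (x : ℝ) : (1 + ‖x‖) ^ (-2 : ℝ) ≤ 1 :=
  Real.rpow_le_one_of_one_le_of_nonpos (by linarith [norm_nonneg x]) (by norm_num)

lemma prod_le_single_of_le_one {κ : Type*} [Fintype κ] {a : κ → ℝ} (h0 : ∀ j, 0 ≤ a j)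
    (h1 : ∀ j, a j ≤ 1) (j : κ) : ∏ i, a i ≤ a j := by
  classical
  rw [← Finset.mul_prod_erase _ _ (Finset.mem_univ j)]
  exact mul_le_of_le_one_right (h0 j) (Finset.prod_le_one (fun i _ ↦ h0 i) fun i _ ↦ h1 i)

lemma HasStripCharFun.exists_nonneg_decay {Ω : Type*} [MeasurableSpace Ω] {Q : Measure Ω}
    {Y : Ω → ℝ} {lm lp : ℝ} {f : ℂ → ℂ}
    (h : HasStripCharFun Q Y lm lp f) :
    ∃ D : ℝ, 0 ≤ D ∧ ∀ ζ ∈ openStrip lm lp, ‖f ζ‖ ≤ D * (1 + ‖ζ.re‖) ^ (-2 : ℝ) := by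
  obtain ⟨D, hD⟩ := h.decay
  refine ⟨max D 0, le_max_right _ _, fun ζ hζ ↦ (hD ζ hζ).trans ?_⟩
  gcongr
  exact le_max_left _ _

lemma HasStripCharFun.exists_bound {Ω : Type*} [MeasurableSpace Ω] {Q : Measure Ω}
    {Y : Ω → ℝ} {lm lp : ℝ} {f : ℂ → ℂ}
    (h : HasStripCharFun Q Y lm lp f) : ∃ D : ℝ, ∀ ζ ∈ openStrip lm lp, ‖f ζ‖ ≤ D := by
  obtain ⟨D, hD0, hD⟩ := h.exists_nonneg_decay
  exact ⟨D, fun ζ hζ ↦ (hD ζ hζ).trans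
    (mul_le_of_le_one_right hD0 (one_add_norm_rpow_le_one _))⟩

section

variable {Ω : Type*} [MeasurableSpace Ω] {Q : Measure Ω} [IsProbabilityMeasure Q]

lemma HasStripCharFun.integrable_exp {Y : Ω → ℝ} {lm lp : ℝ} {f : ℂ → ℂ}
    (h : HasStripCharFun Q Y lm lp f) (hlm : lm < 0) (hlp : 0 < lp) {θ : ℝ}
    (hθ : θ ∈ Set.Ioo (-lp) (-lm)) : Integrable (fun ω ↦ Real.exp (θ * Y ω)) Q := by
  obtain ⟨D, hD⟩ := h.exists_bound
  exact integrable_exp_mul_of_strip h.measurable hlm hlp h.holomorphic hD h.charFun_eq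
    ⟨by linarith [hθ.2], by linarith [hθ.1]⟩

lemma HasStripCharFun.integral_cexp {Y : Ω → ℝ} {lm lp : ℝ} {f : ℂ → ℂ}
    (h : HasStripCharFun Q Y lm lp f) (hlm : lm < 0) (hlp : 0 < lp) {ζ : ℂ}
    (hζ : ζ ∈ openStrip lm lp) : ∫ ω, Complex.exp (Complex.I * ζ * Y ω) ∂Q = f ζ := by
  obtain ⟨D, hD⟩ := h.exists_bound
  exact integral_cexp_of_strip h.measurable hlm hlp h.holomorphic hD h.charFun_eq hζ

lemma integrable_prod_of_iIndepFun {κ : Type*} [Fintype κ] {Y : κ → Ω → ℝ}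
    (hY : ∀ j, Measurable (Y j)) (hind : iIndepFun Y Q) {u : κ → ℝ → ℝ}
    (hum : ∀ j, Measurable (u j)) (hu : ∀ j, Integrable (fun ω ↦ u j (Y j ω)) Q) :
    Integrable (fun ω ↦ ∏ j, u j (Y j ω)) Q := by
  have hprob : ∀ j, IsProbabilityMeasure (Measure.map (Y j) Q) := fun j ↦
    Measure.isProbabilityMeasure_map (hY j).aemeasurable
  have hmap := (iIndepFun_iff_map_fun_eq_pi_map fun j ↦ (hY j).aemeasurable).1 hind
  have h : Integrable (fun y : κ → ℝ ↦ ∏ j, u j (y j)) (Measure.map (fun ω j ↦ Y j ω) Q) := by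
    rw [hmap]
    refine Integrable.fintype_prod fun j ↦ ?_
    exact (integrable_map_measure (hum j).aestronglyMeasurable (hY j).aemeasurable).2 (hu j)
  exact h.comp_measurable (measurable_pi_lambda _ hY)

variable {κ : Type*} [Fintype κ] {Y : κ → Ω → ℝ} {lm lp : ℝ} {f : κ → ℂ → ℂ}

lemma integrable_exp_sum (hY : ∀ j, HasStripCharFun Q (Y j) lm lp (f j)) (hind : iIndepFun Y Q)
    (hlm : lm < 0) (hlp : 0 < lp) {θ : κ → ℝ} (hθ : ∀ j, θ j ∈ Set.Ioo (-lp) (-lm)) :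
    Integrable (fun ω ↦ Real.exp (∑ j, θ j * Y j ω)) Q := by
  simp_rw [Real.exp_sum]
  exact integrable_prod_of_iIndepFun (u := fun j y ↦ Real.exp (θ j * y))
    (fun j ↦ (hY j).measurable) hind (fun j ↦ by fun_prop)
    fun j ↦ (hY j).integrable_exp hlm hlp (hθ j)

lemma integral_cexp_sum (hY : ∀ j, HasStripCharFun Q (Y j) lm lp (f j)) (hind : iIndepFun Y Q)
    (hlm : lm < 0) (hlp : 0 < lp) {ζ : κ → ℂ} (hζ : ∀ j, ζ j ∈ openStrip lm lp) :
    ∫ ω, Complex.exp (Complex.I * ∑ j, ζ j * Y j ω) ∂Q = ∏ j, f j (ζ j) := by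
  have h := hind.integral_fun_prod_comp (𝕜 := ℂ)
    (f := fun j (y : ℝ) ↦ Complex.exp (Complex.I * ζ j * y))
    (fun j ↦ (hY j).measurable.aemeasurable)
    (fun j ↦ Measurable.aestronglyMeasurable (by fun_prop))
  simp_rw [(hY _).integral_cexp hlm hlp (hζ _)] at h
  rw [← h]
  simp_rw [← Complex.exp_sum, Finset.mul_sum, mul_assoc]

/-- A nontrivial linear combination of independent variables with integrable characteristic
functions has no atoms. -/
lemma measure_sum_eq_zero (hY : ∀ j, HasStripCharFun Q (Y j) lm lp (f j)) (hind : iIndepFun Y Q)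
    (hlm : lm < 0) (hlp : 0 < lp) {β : κ → ℝ} {j₀ : κ} (hβ : β j₀ ≠ 0) (a : ℝ) :
    Q {ω | ∑ j, β j * Y j ω = a} = 0 := by
  have hreal : ∀ x : ℝ, (x : ℂ) ∈ openStrip lm lp := fun x ↦ by simp [openStrip, hlm, hlp]
  choose D hD0 hD using fun j ↦ (hY j).exists_nonneg_decay
  have hm : ∀ j, Measurable (Y j) := fun j ↦ (hY j).measurable
  refine measure_eq_zero_of_integrable_charFun (F := fun x ↦ ∏ j, f j ((β j * x : ℝ) : ℂ))
    (by fun_prop) ?_ (fun x ↦ ?_) a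
  · have hg : Integrable fun x : ℝ ↦ (∏ j, D j) * (1 + ‖β j₀ * x‖) ^ (-2 : ℝ) :=
      ((integrable_one_add_norm (E := ℝ) (by simp)).comp_mul_left' hβ).const_mul _
    refine hg.mono' (Continuous.aestronglyMeasurable ?_) (ae_of_all _ fun x ↦ ?_)
    · refine continuous_finsetProd _ fun j _ ↦ ?_
      exact (hY j).holomorphic.continuousOn.comp_continuous (by fun_prop) fun x ↦ hreal _
    · rw [norm_prod]
      calc ∏ j, ‖f j ((β j * x : ℝ) : ℂ)‖ ≤ ∏ j, D j * (1 + ‖β j * x‖) ^ (-2 : ℝ) :=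
            Finset.prod_le_prod (fun _ _ ↦ norm_nonneg _) fun j _ ↦ hD j _ (hreal _)
        _ = (∏ j, D j) * ∏ j, (1 + ‖β j * x‖) ^ (-2 : ℝ) := Finset.prod_mul_distrib
        _ ≤ _ := by
            refine mul_le_mul_of_nonneg_left ?_ (Finset.prod_nonneg fun j _ ↦ hD0 j)
            exact prod_le_single_of_le_one (fun j ↦ by positivity)
              (fun j ↦ one_add_norm_rpow_le_one _) j₀
  · rw [← integral_cexp_sum hY hind hlm hlp fun j ↦ hreal _]
    congr 1 with ω
    push_cast
    rw [mul_assoc, Finset.mul_sum]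
    congr 2
    exact Finset.sum_congr rfl fun j _ ↦ by ring

end

/-! ### Fourier pricing for independent increments -/

lemma contourPoint_im {N : ℕ} (w om x : Fin N → ℝ) (n : Fin N) :
    (contourPoint w om x n).im = -(w n * om n) := by
  simp [contourPoint]

lemma contourPoint_re {N : ℕ} (w om x : Fin N → ℝ) (n : Fin N) :
    (contourPoint w om x n).re = x n := by
  simp [contourPoint]

lemma norm_inv_contourPoint_le {N : ℕ} {w om : Fin N → ℝ} (hw : ∀ n, w n = 1 ∨ w n = -1)
    (hom : ∀ n, 0 < om n) (x : Fin N → ℝ) (n : Fin N) :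
    ‖contourPoint w om x n‖⁻¹ ≤ (1 + (om n)⁻¹) * (1 + ‖x n‖)⁻¹ := by
  have hre : ‖x n‖ ≤ ‖contourPoint w om x n‖ := by
    simpa [contourPoint_re] using Complex.abs_re_le_norm (contourPoint w om x n)
  have him : om n ≤ ‖contourPoint w om x n‖ := by
    have h := Complex.abs_im_le_norm (contourPoint w om x n)
    rw [contourPoint_im, abs_neg, abs_mul, abs_of_pos (hom n)] at h
    rcases hw n with hn | hn <;> simpa [hn] using h
  have hpos : 0 < ‖contourPoint w om x n‖ := (hom n).trans_le him
  have hx : 0 < 1 + ‖x n‖ := by positivity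
  rw [← div_eq_mul_inv, inv_le_comm₀ hpos (by have := hom n; positivity), inv_div,
    div_le_iff₀ (by have := hom n; positivity)]
  have h1 : 1 ≤ ‖contourPoint w om x n‖ * (om n)⁻¹ := by
    rw [← div_eq_mul_inv, one_le_div (hom n)]
    exact him
  linarith

lemma contourPoint_ne_zero {N : ℕ} {w om : Fin N → ℝ} (hw : ∀ n, w n = 1 ∨ w n = -1)
    (hom : ∀ n, 0 < om n) (x : Fin N → ℝ) (n : Fin N) : contourPoint w om x n ≠ 0 := by
  intro h
  have him := contourPoint_im w om x n
  rw [h, Complex.zero_im] at him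
  have := hom n
  rcases hw n with hn | hn <;> rw [hn] at him <;> linarith

/-- The pricing integrand in terms of the characteristic functions `f j` of the increments, the
coefficients `B n j` of the increments in the exercise conditions, and the constants `c n`. -/
noncomputable def fourierIntegrand {κ : Type*} [Fintype κ] {N : ℕ}
    (f : κ → ℂ → ℂ) (B : Fin N → κ → ℝ) (g : κ → ℝ)
    (c : Fin N → ℝ) (ξ : Fin N → ℂ) : ℂ :=
  1 / (∏ n, ξ n) * (Complex.exp (Complex.I * ∑ n, ξ n * c n)
    * ∏ j, f j ((∑ n, B n j * ξ n) - Complex.I * g j))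

lemma mem_openStrip_of_contour {κ : Type*} {lm lp : ℝ} {N : ℕ} {w om : Fin N → ℝ}
    {B : Fin N → κ → ℝ} {g : κ → ℝ}
    (hstrip : ∀ j, (∑ n, w n * om n * B n j) + g j ∈ Set.Ioo (-lp) (-lm)) (x : Fin N → ℝ)
    (j : κ) : (∑ n, B n j * contourPoint w om x n) - Complex.I * g j ∈ openStrip lm lp := by
  have him : ((∑ n, B n j * contourPoint w om x n) - Complex.I * g j).im
      = -((∑ n, w n * om n * B n j) + g j) := by
    simp only [Complex.sub_im, Complex.im_sum, 
      contourPoint_im, Complex.mul_im, Complex.I_re, Complex.I_im, Complex.ofReal_re,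
      Complex.ofReal_im, zero_mul, one_mul, zero_add, neg_add, ← Finset.sum_neg_distrib]
    rw [← sub_eq_add_neg]
    congr 1
    exact Finset.sum_congr rfl fun n _ ↦ by ring
  simp only [openStrip, Set.mem_ofPred_eq, him, Set.mem_Ioo]
  exact ⟨by linarith [(hstrip j).2], by linarith [(hstrip j).1]⟩

/-- The exponential weight `exp (∑ g Y + ∑ ω w V)`, with `V n = ∑ B n j Y j + c n`, as the
exponential of a combination of the independent variables. -/
lemma weight_eq {Ω κ : Type*} [Fintype κ] {Y : κ → Ω → ℝ} {N : ℕ}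
    (w om : Fin N → ℝ) (B : Fin N → κ → ℝ) (g : κ → ℝ) (c : Fin N → ℝ) (ω : Ω) :
    Real.exp ((∑ j, g j * Y j ω) + ∑ n, om n * (w n * ((∑ j, B n j * Y j ω) + c n)))
      = Real.exp (∑ n, w n * om n * c n)
        * Real.exp (∑ j, ((∑ n, w n * om n * B n j) + g j) * Y j ω) := by
  rw [← Real.exp_add]
  congr 1
  simp only [add_mul, mul_add, Finset.sum_add_distrib, Finset.sum_mul, Finset.mul_sum]
  rw [Finset.sum_comm]
  have h1 : ∀ n j, om n * (w n * (B n j * Y j ω)) = w n * om n * B n j * Y j ω := fun n j ↦ by ring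
  have h2 : ∀ n, om n * (w n * c n) = w n * om n * c n := fun n ↦ by ring
  simp only [h1, h2]
  ring

/-- The damped, weighted form of the payoff: the damping in `dampedOrthant` cancels the factor
`exp (∑ ω w V)` in the weight. -/
lemma weight_mul_dampedOrthant {N : ℕ} (w om V : Fin N → ℝ) (a : ℝ) :
    ((Real.exp (a + ∑ n, om n * (w n * V n)) : ℝ) : ℂ)
        * dampedOrthant w om (WithLp.toLp 2 V)
      = ((Real.exp a * ∏ n, (if 0 ≤ w n * V n then 1 else 0) : ℝ) : ℂ) := by
  rw [Real.exp_add, Real.exp_sum, dampedOrthant]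
  push_cast
  rw [mul_assoc, ← Finset.prod_mul_distrib]
  congr 1
  refine Finset.prod_congr rfl fun n _ ↦ ?_
  simp only [dampedStep]
  split_ifs
  · rw [← Complex.exp_add]
    push_cast
    simp
  · simp

section

variable {Ω : Type*} [MeasurableSpace Ω] {Q : Measure Ω}
  {κ : Type*} [Fintype κ] {Y : κ → Ω → ℝ} {lm lp : ℝ} {f : κ → ℂ → ℂ}

/-- The decay in the `j`-th linear form comes from the `j`-th characteristic function, and each
variable of integration occurs in one of these forms because no row of `B` vanishes. -/
lemma integrable_fourierIntegrand (hY : ∀ j, HasStripCharFun Q (Y j) lm lp (f j)) {N : ℕ}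
    {w om : Fin N → ℝ} (hw : ∀ n, w n = 1 ∨ w n = -1) (hom : ∀ n, 0 < om n)
    {B : Fin N → κ → ℝ} (hB : ∀ n, ∃ j, B n j ≠ 0) {g : κ → ℝ} (c : Fin N → ℝ)
    (hstrip : ∀ j, (∑ n, w n * om n * B n j) + g j ∈ Set.Ioo (-lp) (-lm)) :
    Integrable fun x : Fin N → ℝ ↦ fourierIntegrand f B g c (contourPoint w om x) := by
  have hmem := mem_openStrip_of_contour (lm := lm) (lp := lp) hstrip
  choose D hD0 hD using fun j ↦ (hY j).exists_nonneg_decay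
  choose J hJ using hB
  have hcont : Continuous fun x : Fin N → ℝ ↦ contourPoint w om x := by
    unfold contourPoint
    fun_prop
  have hcontn : ∀ n, Continuous fun x : Fin N → ℝ ↦ contourPoint w om x n := fun n ↦
    (continuous_apply n).comp hcont
  have hmeas : Continuous fun x : Fin N → ℝ ↦ fourierIntegrand f B g c (contourPoint w om x) := by
    unfold fourierIntegrand
    refine (continuous_const.div (continuous_finsetProd _ fun n _ ↦ hcontn n) fun x ↦
      Finset.prod_ne_zero_iff.2 fun n _ ↦ contourPoint_ne_zero hw hom x n).mul
      (Continuous.mul (by fun_prop) (continuous_finsetProd _ fun j _ ↦ ?_))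
    exact (hY j).holomorphic.continuousOn.comp_continuous (by fun_prop) fun x ↦ hmem x j
  have hre : ∀ x j, ((∑ n, B n j * contourPoint w om x n) - Complex.I * g j).re
      = ∑ n, B n j * x n := by
    intro x j
    simp [contourPoint_re]
  have hexp : ∀ x, ‖Complex.exp (Complex.I * ∑ n, contourPoint w om x n * c n)‖
      = Real.exp (∑ n, w n * om n * c n) := by
    intro x
    rw [Complex.norm_exp]
    congr 1
    simp [contourPoint_im, ← Finset.sum_neg_distrib]
  set E : ℝ := (∏ n, (1 + (om n)⁻¹)) * (Real.exp (∑ n, w n * om n * c n) * ∏ j, D j)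
  have hE : 0 ≤ E := by
    have h1 : 0 ≤ ∏ n, (1 + (om n)⁻¹) := Finset.prod_nonneg fun n _ ↦ by
      have := hom n
      positivity
    have h2 : 0 ≤ ∏ j, D j := Finset.prod_nonneg fun j _ ↦ hD0 j
    positivity
  have hmain : ∀ x, ‖fourierIntegrand f B g c (contourPoint w om x)‖
      ≤ E * (∏ n, (1 + ‖x n‖)⁻¹) * ∏ j, (1 + ‖∑ n, B n j * x n‖) ^ (-2 : ℝ) := by
    intro x
    have h1 : ‖1 / ∏ n, contourPoint w om x n‖
        ≤ (∏ n, (1 + (om n)⁻¹)) * ∏ n, (1 + ‖x n‖)⁻¹ := by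
      rw [norm_div, norm_one, norm_prod, one_div, ← Finset.prod_inv_distrib,
        ← Finset.prod_mul_distrib]
      exact Finset.prod_le_prod (fun _ _ ↦ by positivity)
        fun n _ ↦ norm_inv_contourPoint_le hw hom x n
    have h2 : ‖∏ j, f j ((∑ n, B n j * contourPoint w om x n) - Complex.I * g j)‖
        ≤ (∏ j, D j) * ∏ j, (1 + ‖∑ n, B n j * x n‖) ^ (-2 : ℝ) := by
      rw [norm_prod, ← Finset.prod_mul_distrib]
      refine Finset.prod_le_prod (fun _ _ ↦ norm_nonneg _) fun j _ ↦ ?_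
      have h := hD j _ (hmem x j)
      rwa [hre] at h
    rw [fourierIntegrand, norm_mul, norm_mul, hexp]
    calc _ ≤ ((∏ n, (1 + (om n)⁻¹)) * ∏ n, (1 + ‖x n‖)⁻¹) * (Real.exp (∑ n, w n * om n * c n)
          * ((∏ j, D j) * ∏ j, (1 + ‖∑ n, B n j * x n‖) ^ (-2 : ℝ))) :=
          mul_le_mul h1 (by gcongr) (by positivity) ((norm_nonneg _).trans h1)
      _ = _ := by simp only [E]; ring
  have hprod : ∀ x : Fin N → ℝ, 0 ≤ E * ∏ n, (1 + ‖x n‖)⁻¹ := fun x ↦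
    mul_nonneg hE (Finset.prod_nonneg fun n _ ↦ by positivity)
  refine integrable_of_le_prod_inv hmeas.aestronglyMeasurable hE (l := fun n i ↦ B i (J n))
    hJ (fun x ↦ (hmain x).trans ?_) fun n x ↦ (hmain x).trans ?_
  · exact mul_le_of_le_one_right (hprod x) (Finset.prod_le_one (fun j _ ↦ by positivity)
      fun j _ ↦ one_add_norm_rpow_le_one _)
  · exact mul_le_mul_of_nonneg_left (prod_le_single_of_le_one (fun j ↦ by positivity)
      (fun j ↦ one_add_norm_rpow_le_one _) (J n)) (hprod x)

variable [IsProbabilityMeasure Q]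

open scoped RealInnerProductSpace in
/-- The Fourier transform of the weighted law of `V` factorizes over the independent variables. The
weight moves the frequency from the real point `2πv` to the contour. -/
lemma integral_weight_mul_cexp (hY : ∀ j, HasStripCharFun Q (Y j) lm lp (f j))
    (hind : iIndepFun Y Q) (hlm : lm < 0) (hlp : 0 < lp) {N : ℕ} {w om : Fin N → ℝ}
    {B : Fin N → κ → ℝ} {g : κ → ℝ} (c : Fin N → ℝ)
    (hstrip : ∀ j, (∑ n, w n * om n * B n j) + g j ∈ Set.Ioo (-lp) (-lm))
    (v : EuclideanSpace ℝ (Fin N)) :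
    ∫ ω, ((Real.exp ((∑ j, g j * Y j ω)
          + ∑ n, om n * (w n * ((∑ j, B n j * Y j ω) + c n))) : ℝ) : ℂ)
        * Complex.exp (↑(2 * Real.pi
          * ⟪(WithLp.toLp 2 fun n ↦ (∑ j, B n j * Y j ω) + c n : EuclideanSpace ℝ (Fin N)), v⟫)
            * Complex.I) ∂Q
      = Complex.exp (Complex.I * ∑ n, contourPoint w om (fun n ↦ 2 * Real.pi * v n) n * c n)
        * ∏ j, f j ((∑ n, B n j * contourPoint w om (fun n ↦ 2 * Real.pi * v n) n)
            - Complex.I * g j) := by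
  rw [← integral_cexp_sum hY hind hlm hlp
    fun j ↦ mem_openStrip_of_contour hstrip (fun n ↦ 2 * Real.pi * v n) j, ← integral_const_mul]
  congr 1 with ω
  rw [Complex.ofReal_exp, ← Complex.exp_add, ← Complex.exp_add]
  congr 1
  have hξ : ∀ n, Complex.I * contourPoint w om (fun n ↦ 2 * Real.pi * v n) n
      = Complex.I * (2 * Real.pi * v n) + w n * om n := by
    intro n
    simp only [contourPoint]
    push_cast
    linear_combination (-(w n : ℂ) * om n) * Complex.I_sq
  have hsum : Complex.I * ∑ j, ((∑ n, B n j * contourPoint w om (fun n ↦ 2 * Real.pi * v n) n)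
        - Complex.I * g j) * Y j ω
      = (∑ n, ∑ j, (Complex.I * contourPoint w om (fun n ↦ 2 * Real.pi * v n) n)
          * (B n j * Y j ω)) + ∑ j, (g j * Y j ω : ℂ) := by
    rw [Finset.sum_comm, ← Finset.sum_add_distrib, Finset.mul_sum]
    refine Finset.sum_congr rfl fun j _ ↦ ?_
    rw [sub_mul, mul_sub, Finset.sum_mul, Finset.mul_sum]
    rw [show Complex.I * (Complex.I * g j * Y j ω) = -(g j * Y j ω) by
      linear_combination ((g j : ℂ) * Y j ω) * Complex.I_sq, sub_neg_eq_add]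
    congr 1
    exact Finset.sum_congr rfl fun n _ ↦ by ring
  rw [hsum, Finset.mul_sum, ← add_assoc, ← Finset.sum_add_distrib]
  simp only [← Finset.mul_sum, ← mul_assoc Complex.I, hξ, ← mul_add]
  rw [PiLp.inner_apply]
  push_cast
  rw [Finset.mul_sum, Finset.sum_mul, add_assoc, ← Finset.sum_add_distrib, add_comm]
  congr 1
  refine Finset.sum_congr rfl fun n _ ↦ ?_
  simp
  ring

/-- Fourier pricing of a digital payoff with exponential factor, for independent increments whose
characteristic functions extend to a strip: the payoff and the Fourier integrand are integrable,
and the expectation is the contour integral. -/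
theorem fourier_pricing (hY : ∀ j, HasStripCharFun Q (Y j) lm lp (f j))
    (hind : iIndepFun Y Q) (hlm : lm < 0) (hlp : 0 < lp) {N : ℕ} {w om : Fin N → ℝ}
    (hw : ∀ n, w n = 1 ∨ w n = -1) (hom : ∀ n, 0 < om n)
    {B : Fin N → κ → ℝ} (hB : ∀ n, ∃ j, B n j ≠ 0) {g : κ → ℝ} (c : Fin N → ℝ)
    (hstrip : ∀ j, (∑ n, w n * om n * B n j) + g j ∈ Set.Ioo (-lp) (-lm)) :
    ((∫ ω, Real.exp (∑ j, g j * Y j ω)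
        * ∏ n, (if 0 ≤ w n * ((∑ j, B n j * Y j ω) + c n) then 1 else 0) ∂Q : ℝ) : ℂ)
      = 1 / (2 * Real.pi * Complex.I) ^ N * (∏ n, (w n : ℂ))
        * ∫ x : Fin N → ℝ, fourierIntegrand f B g c (contourPoint w om x) := by
  have hm : ∀ j, Measurable (Y j) := fun j ↦ (hY j).measurable
  set V : Ω → EuclideanSpace ℝ (Fin N) :=
    fun ω ↦ WithLp.toLp 2 fun n ↦ (∑ j, B n j * Y j ω) + c n with hV
  have hVm : Measurable V := by
    refine (MeasurableEquiv.toLp 2 (Fin N → ℝ)).measurable.comp ?_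
    fun_prop
  set W : Ω → ℂ := fun ω ↦ ((Real.exp ((∑ j, g j * Y j ω)
    + ∑ n, om n * (w n * ((∑ j, B n j * Y j ω) + c n))) : ℝ) : ℂ) with hW
  have hWm : Measurable W := by fun_prop
  have hWint : Integrable W Q := by
    have h := (integrable_exp_sum hY hind hlm hlp hstrip).const_mul
      (Real.exp (∑ n, w n * om n * c n))
    simp_rw [← weight_eq (Y := Y)] at h
    exact h.ofReal
  have hcont : ∀ᵐ ω ∂Q, ContinuousAt (dampedOrthant w om) (V ω) := by
    have h : ∀ᵐ ω ∂Q, ∀ n, ∑ j, B n j * Y j ω ≠ -c n := by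
      rw [ae_all_iff]
      intro n
      obtain ⟨j, hj⟩ := hB n
      rw [ae_iff]
      simpa using measure_sum_eq_zero hY hind hlm hlp hj (-c n)
    filter_upwards [h] with ω hω
    refine continuousAt_dampedOrthant fun n ↦ mul_ne_zero ?_ fun h0 ↦ hω n ?_
    · rcases hw n with hn | hn <;> simp [hn]
    · simp only [hV] at h0
      linarith
  set Φ : (Fin N → ℝ) → ℂ := fun x ↦ ((∏ n, (w n : ℂ)) / Complex.I ^ N)
    * fourierIntegrand f B g c (contourPoint w om x) with hΦ
  have hΦint : Integrable Φ := (integrable_fourierIntegrand hY hw hom hB c hstrip).const_mul _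
  have hpi : (2 * Real.pi) ≠ 0 := by positivity
  have hΦscale : Integrable fun x : Fin N → ℝ ↦ Φ ((2 * Real.pi) • x) := hΦint.comp_smul hpi
  have hkey : ∀ v : EuclideanSpace ℝ (Fin N), FourierTransform.fourier (dampedOrthant w om) v
      * ∫ ω, W ω * Complex.exp (↑(2 * Real.pi * inner ℝ (V ω) v) * Complex.I) ∂Q
      = Φ ((2 * Real.pi) • WithLp.ofLp v) := by
    intro v
    rw [fourier_dampedOrthant hw hom, integral_weight_mul_cexp hY hind hlm hlp c hstrip]
    simp only [hΦ, fourierIntegrand]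
    rw [← mul_assoc ((∏ n, (w n : ℂ)) / Complex.I ^ N)]
    congr 1
    rw [Finset.prod_div_distrib, Finset.prod_mul_distrib, Finset.prod_const, Finset.card_univ,
      Fintype.card_fin, div_mul_div_comm, mul_one]
    rfl
  have hmain := integral_mul_comp_eq_integral_fourier hWm hWint hVm
    (measurable_dampedOrthant w om) (integrable_dampedOrthant hw hom)
    (norm_dampedOrthant_le_one hom) hcont (by
      simp_rw [hkey]
      exact (PiLp.volume_preserving_ofLp (Fin N)).integrable_comp_of_integrable hΦscale)
  simp_rw [hkey] at hmain
  rw [(PiLp.volume_preserving_ofLp (Fin N)).integral_comp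
    (MeasurableEquiv.toLp 2 (Fin N → ℝ)).symm.measurableEmbedding
      (fun x : Fin N → ℝ ↦ Φ ((2 * Real.pi) • x)),
    Measure.integral_comp_smul, Module.finrank_fin_fun] at hmain
  simp only [hW, hV, weight_mul_dampedOrthant, integral_complex_ofReal] at hmain
  rw [hmain, hΦ, integral_const_mul, abs_of_pos (by positivity), Complex.real_smul]
  push_cast
  rw [mul_pow, mul_pow, mul_pow]
  field_simp

/-- A digital payoff with exponential factor is integrable as soon as the exponential that
dominates it is. -/
lemma integrable_digital (hm : ∀ j, Measurable (Y j)) (hind : iIndepFun Y Q) {N : ℕ}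
    {w om : Fin N → ℝ} (hom : ∀ n, 0 < om n) {B : Fin N → κ → ℝ} {g : κ → ℝ} (c : Fin N → ℝ)
    (hexp : ∀ j, Integrable (fun ω ↦ Real.exp (((∑ n, w n * om n * B n j) + g j) * Y j ω)) Q) :
    Integrable (fun ω ↦ Real.exp (∑ j, g j * Y j ω)
        * ∏ n, (if 0 ≤ w n * ((∑ j, B n j * Y j ω) + c n) then 1 else 0)) Q := by
  have hW : Integrable (fun ω ↦ Real.exp ((∑ j, g j * Y j ω)
      + ∑ n, om n * (w n * ((∑ j, B n j * Y j ω) + c n)))) Q := by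
    simp_rw [weight_eq (Y := Y)]
    refine Integrable.const_mul ?_ _
    simp_rw [Real.exp_sum]
    exact integrable_prod_of_iIndepFun
      (u := fun j y ↦ Real.exp (((∑ n, w n * om n * B n j) + g j) * y)) hm hind
      (fun j ↦ by fun_prop) hexp
  refine hW.mono' (Measurable.aestronglyMeasurable ?_) (ae_of_all _ fun ω ↦ ?_)
  · refine Measurable.mul (by fun_prop) (Finset.measurable_prod _ fun n _ ↦ ?_)
    exact Measurable.ite (measurableSet_le measurable_const (by fun_prop)) measurable_const
      measurable_const
  · rw [← Complex.norm_real, ← weight_mul_dampedOrthant w om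
      (fun n ↦ (∑ j, B n j * Y j ω) + c n), norm_mul, Complex.norm_real,
      Real.norm_of_nonneg (Real.exp_pos _).le]
    exact mul_le_of_le_one_right (Real.exp_pos _).le (norm_dampedOrthant_le_one hom _)

end

/-! ### The exponent of a regular Lévy process of exponential type -/

lemma IsRLPEExponent.differentiableOn {υ lm lp : ℝ} {ψ : ℂ → ℂ}
    (h : IsRLPEExponent υ lm lp ψ) : DifferentiableOn ℂ ψ (openStrip lm lp) := by
  obtain ⟨-, -, -, μ, φ, hψ, hφ, -⟩ := h
  refine DifferentiableOn.congr (f := fun ξ ↦ -Complex.I * μ * ξ + φ ξ) ?_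
    fun ξ hξ ↦ hψ ξ (Set.Ioo_subset_Icc_self hξ)
  fun_prop

lemma isLittleO_rpow_rpow_of_lt {a b : ℝ} (hab : a < b) :
    (fun x : ℝ ↦ x ^ a) =o[atTop] fun x : ℝ ↦ x ^ b := by
  refine Asymptotics.isLittleO_of_tendsto' ?_ ?_
  · filter_upwards [eventually_gt_atTop 0] with x hx h
    exact absurd h (Real.rpow_pos_of_pos hx b).ne'
  · refine (tendsto_rpow_neg_atTop (sub_pos.2 hab)).congr' ?_
    filter_upwards [eventually_gt_atTop 0] with x hx
    rw [neg_sub, Real.rpow_sub hx]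

/-- The leading term `C |ξ|^υ` of the exponent gives `exp (-Δ ψ)` quadratic decay in the strip;
it decays faster than any power, but no more is needed. -/
lemma IsRLPEExponent.exists_decay {υ lm lp : ℝ} {ψ : ℂ → ℂ}
    (h : IsRLPEExponent υ lm lp ψ) {Δ : ℝ} (hΔ : 0 < Δ) :
    ∃ D : ℝ, ∀ ζ ∈ closedStrip lm lp,
      ‖Complex.exp (-(Δ : ℂ) * ψ ζ)‖ ≤ D * (1 + ‖ζ.re‖) ^ (-2 : ℝ) := by
  obtain ⟨⟨hυ, -⟩, -, -, μ, φ, hψ, -, hφc, ⟨C, hC, υ₁, hυ₁, hO⟩, -⟩ := h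
  set S := closedStrip lm lp with hS
  set l : Filter ℂ := Bornology.cobounded ℂ ⊓ 𝓟 S with hl
  have hnorm : Tendsto (fun ξ : ℂ ↦ ‖ξ‖) l atTop :=
    tendsto_norm_cobounded_atTop.mono_left inf_le_left
  have hlittle : (fun ξ : ℂ ↦ φ ξ - ((C * ‖ξ‖ ^ υ : ℝ) : ℂ)) =o[l] fun ξ : ℂ ↦ ‖ξ‖ ^ υ :=
    hO.trans_isLittleO ((isLittleO_rpow_rpow_of_lt hυ₁).comp_tendsto hnorm)
  have hlower : ∀ᶠ ξ in l, C / 2 * ‖ξ‖ ^ υ ≤ (φ ξ).re := by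
    filter_upwards [hlittle.bound (half_pos hC)] with ξ hξ
    have hpos : 0 ≤ ‖ξ‖ ^ υ := Real.rpow_nonneg (norm_nonneg _) _
    rw [Real.norm_of_nonneg hpos] at hξ
    have h1 := (abs_le.1 ((Complex.abs_re_le_norm _).trans hξ)).1
    rw [Complex.sub_re, Complex.ofReal_re] at h1
    linarith
  set c : ℝ := Δ * (C / 2) with hc
  have hcpos : 0 < c := by positivity
  have hdecay : Tendsto (fun x : ℝ ↦ x ^ 2 * Real.exp (-c * x ^ υ)) atTop (𝓝 0) := by
    refine ((tendsto_rpow_mul_exp_neg_mul_atTop_nhds_zero (2 / υ) c hcpos).comp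
      (tendsto_rpow_atTop hυ)).congr' ?_
    filter_upwards [eventually_ge_atTop 0] with x hx
    simp only [Function.comp_apply]
    rw [← Real.rpow_mul hx, mul_div_cancel₀ _ hυ.ne', Real.rpow_two]
  set L : ℝ := Δ * (|μ| * (|lm| + |lp|)) with hL
  have hdrift : ∀ ζ ∈ S, -(|μ| * (|lm| + |lp|)) ≤ μ * ζ.im := by
    intro ζ hζ
    have him : |ζ.im| ≤ |lm| + |lp| := by
      have h1 : lm ≤ ζ.im := hζ.1
      have h2 : ζ.im ≤ lp := hζ.2
      rw [abs_le]
      constructor <;> linarith [neg_abs_le lm, le_abs_self lp, abs_nonneg lm, abs_nonneg lp]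
    have h3 : |μ * ζ.im| ≤ |μ| * (|lm| + |lp|) := by
      rw [abs_mul]
      gcongr
    exact (abs_le.1 h3).1
  have hre : ∀ ζ ∈ S, (ψ ζ).re = μ * ζ.im + (φ ζ).re := by
    intro ζ hζ
    rw [hψ ζ hζ]
    simp
  have hfar : ∀ᶠ ζ in l,
      ‖Complex.exp (-(Δ : ℂ) * ψ ζ)‖ * (1 + ‖ζ.re‖) ^ 2 ≤ 4 * Real.exp L := by
    filter_upwards [hlower, (hdecay.comp hnorm).eventually_le_const one_pos,
      hnorm.eventually_ge_atTop 1, mem_inf_of_right (mem_principal_self S)] with ζ h1 h2 h3 h4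
    have hexp : ‖Complex.exp (-(Δ : ℂ) * ψ ζ)‖ ≤ Real.exp L * Real.exp (-c * ‖ζ‖ ^ υ) := by
      rw [Complex.norm_exp, ← Real.exp_add, Real.exp_le_exp, ← Complex.ofReal_neg,
        Complex.re_ofReal_mul, hre ζ h4]
      have h5 := hdrift ζ h4
      have h6 : -(|μ| * (|lm| + |lp|)) + C / 2 * ‖ζ‖ ^ υ ≤ μ * ζ.im + (φ ζ).re := add_le_add h5 h1
      have h7 := mul_le_mul_of_nonneg_left h6 hΔ.le
      rw [hL, hc]
      linarith
    have hsq : (1 + ‖ζ.re‖) ^ 2 ≤ 4 * ‖ζ‖ ^ 2 := by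
      have h5 : ‖ζ.re‖ ≤ ‖ζ‖ := Complex.abs_re_le_norm ζ
      have h6 : 1 + ‖ζ.re‖ ≤ 2 * ‖ζ‖ := by linarith
      calc (1 + ‖ζ.re‖) ^ 2 ≤ (2 * ‖ζ‖) ^ 2 := by gcongr
        _ = _ := by ring
    simp only [Function.comp_apply] at h2
    calc _ ≤ (Real.exp L * Real.exp (-c * ‖ζ‖ ^ υ)) * (4 * ‖ζ‖ ^ 2) := by gcongr
      _ = 4 * Real.exp L * (‖ζ‖ ^ 2 * Real.exp (-c * ‖ζ‖ ^ υ)) := by ring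
      _ ≤ 4 * Real.exp L := mul_le_of_le_one_right (by positivity) h2
  obtain ⟨R, -, hR⟩ := (Filter.hasBasis_cobounded_norm.inf_principal S).eventually_iff.1 hfar
  have hclosed : IsClosed S := isClosed_Icc.preimage Complex.continuous_im
  have hcompact : IsCompact (Metric.closedBall (0 : ℂ) R ∩ S) :=
    (isCompact_closedBall 0 R).inter_right hclosed
  have hψc : ContinuousOn ψ S :=
    ContinuousOn.congr (f := fun ξ ↦ -Complex.I * μ * ξ + φ ξ) (by fun_prop) hψ
  have hFc : ContinuousOn
      (fun ζ ↦ ‖Complex.exp (-(Δ : ℂ) * ψ ζ)‖ * (1 + ‖ζ.re‖) ^ 2) S := by fun_prop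
  obtain ⟨B, hB⟩ := hcompact.exists_bound_of_continuousOn (hFc.mono Set.inter_subset_right)
  refine ⟨max B (4 * Real.exp L), fun ζ hζ ↦ ?_⟩
  have hpos : 0 < 1 + ‖ζ.re‖ := by positivity
  rw [Real.rpow_neg hpos.le, Real.rpow_two, ← div_eq_mul_inv, le_div_iff₀ (by positivity)]
  rcases le_total ‖ζ‖ R with h | h
  · exact ((le_abs_self _).trans (hB ζ ⟨by simpa using h, hζ⟩)).trans (le_max_left _ _)
  · exact (hR ⟨h, hζ⟩).trans (le_max_right _ _)

/-! ### Increments of the Lévy process -/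

section

variable {Ω : Type*} [MeasurableSpace Ω] {Q : Measure Ω} {X : ℝ≥0 → Ω → ℝ}

lemma IsLevyProcess.integral_cexp_increment (hX : IsLevyProcess Q X) {ψ : ℂ → ℂ}
    (hψ : HasCharExponent Q X ψ) {s t : ℝ≥0} (hst : s ≤ t) (x : ℝ) :
    ∫ ω, Complex.exp (Complex.I * x * (X t ω - X s ω : ℝ)) ∂Q
      = Complex.exp (-((t : ℝ) - s : ℝ) * ψ x) := by
  have h := hX.stationary_increments s (t - s)
  rw [add_tsub_cancel_of_le hst] at h
  have hu : Measurable fun y : ℝ ↦ Complex.exp (Complex.I * x * y) := by fun_prop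
  have h1 := (h.comp hu).integral_eq
  simp only [Function.comp_def] at h1
  rw [h1]
  have h2 := hψ (t - s) x
  rw [NNReal.coe_sub hst] at h2
  rw [← h2]
  refine integral_congr_ae ?_
  filter_upwards [hX.start_zero] with ω hω
  rw [hω, sub_zero]

lemma hasStripCharFun_increment (hX : IsLevyProcess Q X) {ψ : ℂ → ℂ}
    (hψ : HasCharExponent Q X ψ) {υ lm lp : ℝ} (hR : IsRLPEExponent υ lm lp ψ) {s t : ℝ≥0}
    (hst : s < t) :
    HasStripCharFun Q (fun ω ↦ X t ω - X s ω) lm lp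
      fun ζ ↦ Complex.exp (-((t : ℝ) - s : ℝ) * ψ ζ) where
  measurable := (hX.measurable t).sub (hX.measurable s)
  holomorphic := (hR.differentiableOn.const_mul _).cexp
  decay := by
    obtain ⟨D, hD⟩ := hR.exists_decay (Δ := (t : ℝ) - s) (sub_pos.2 (by exact_mod_cast hst))
    exact ⟨D, fun ζ hζ ↦ hD ζ (Set.Ioo_subset_Icc_self hζ)⟩
  charFun_eq := hX.integral_cexp_increment hψ hst.le

/-- The increments over `[0, T 0], [T 0, T 1], …, [T (M-1), T M]`. -/
def incrementFrom (X : ℝ≥0 → Ω → ℝ) {M : ℕ} (T : Fin (M + 1) → ℝ≥0) :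
    Fin (M + 1) → Ω → ℝ :=
  Fin.cons (fun ω ↦ X (T 0) ω - X 0 ω) fun j ω ↦ X (T j.succ) ω - X (T j.castSucc) ω

lemma IsLevyProcess.iIndepFun_incrementFrom (hX : IsLevyProcess Q X) {M : ℕ}
    {T : Fin (M + 1) → ℝ≥0} (hT : Monotone T) : iIndepFun (incrementFrom X T) Q := by
  have hmono : Monotone (Fin.cons 0 T : Fin (M + 2) → ℝ≥0) := by
    refine Fin.monotone_iff_le_succ.2 fun i ↦ ?_
    refine Fin.cases ?_ (fun j ↦ ?_) i
    · simp
    · rw [← Fin.succ_castSucc, Fin.cons_succ, Fin.cons_succ]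
      exact hT j.castSucc_lt_succ.le
  have h := hX.indep_increments (M + 1) _ hmono
  convert h using 1
  ext i
  refine Fin.cases ?_ (fun j ↦ ?_) i
  · simp [incrementFrom]
  · simp [incrementFrom]

lemma IsLevyProcess.measurable_incrementFrom (hX : IsLevyProcess Q X) {M : ℕ}
    (T : Fin (M + 1) → ℝ≥0) (i : Fin (M + 1)) : Measurable (incrementFrom X T i) := by
  refine Fin.cases ?_ (fun j ↦ ?_) i
  · exact (hX.measurable _).sub (hX.measurable _)
  · exact (hX.measurable _).sub (hX.measurable _)

lemma IsLevyProcess.iIndepFun_increment (hX : IsLevyProcess Q X) {M : ℕ}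
    {T : Fin (M + 1) → ℝ≥0} (hT : Monotone T) :
    iIndepFun (fun (j : Fin M) ω ↦ X (T j.succ) ω - X (T j.castSucc) ω) Q :=
  (hX.iIndepFun_incrementFrom hT).precomp (Fin.succ_injective M)

lemma IsLevyProcess.indepFun_current_increments (hX : IsLevyProcess Q X) {M : ℕ}
    {T : Fin (M + 1) → ℝ≥0} (hT : Monotone T) :
    IndepFun (X (T 0)) (fun ω (j : Fin M) ↦ X (T j.succ) ω - X (T j.castSucc) ω) Q := by
  classical
  have h := (hX.iIndepFun_incrementFrom hT).indepFun_finset {0}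
    (Finset.univ.image Fin.succ) (by simp)
    (hX.measurable_incrementFrom T)
  have hmem : ∀ j : Fin M, j.succ ∈ (Finset.univ.image Fin.succ : Finset (Fin (M + 1))) := by simp
  have hfst : Measurable fun y : ({0} : Finset (Fin (M + 1))) → ℝ ↦ y ⟨0, by simp⟩ := by fun_prop
  have hsnd : Measurable fun y : (Finset.image Fin.succ (Finset.univ : Finset (Fin M))) → ℝ ↦
      fun j : Fin M ↦ y ⟨j.succ, hmem j⟩ := by fun_prop
  have h' := h.comp hfst hsnd
  refine h'.congr ?_ (ae_of_all _ fun ω ↦ ?_)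
  · filter_upwards [hX.start_zero] with ω hω
    simp [incrementFrom, hω]
  · ext j
    simp [incrementFrom]

/-- The conditional expectation of a function of `U` and an independent `V`, given `U`, is
obtained by averaging over `V` alone. -/
lemma condExp_comp_of_indepFun [IsProbabilityMeasure Q] {α β : Type*} [MeasurableSpace α]
    [MeasurableSpace β] {U : Ω → α} {V : Ω → β} (hU : Measurable U) (hV : Measurable V)
    (hind : IndepFun U V Q) {G : α × β → ℝ} (hG : Measurable G)
    (hint : Integrable (fun ω ↦ G (U ω, V ω)) Q) :
    Q[fun ω ↦ G (U ω, V ω) | MeasurableSpace.comap U inferInstance]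
      =ᵐ[Q] fun ω ↦ ∫ ω', G (U ω, V ω') ∂Q := by
  have hlaw := (indepFun_iff_map_prod_eq_prod_map_map hU.aemeasurable hV.aemeasurable).1 hind
  have hUp : IsProbabilityMeasure (Q.map U) := Measure.isProbabilityMeasure_map hU.aemeasurable
  have hVp : IsProbabilityMeasure (Q.map V) := Measure.isProbabilityMeasure_map hV.aemeasurable
  have hGint : Integrable G ((Q.map U).prod (Q.map V)) := by
    rw [← hlaw]
    exact (integrable_map_measure hG.aestronglyMeasurable (hU.prodMk hV).aemeasurable).2 hint
  set k : α → ℝ := fun u ↦ ∫ v, G (u, v) ∂(Q.map V) with hk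
  have hkm : StronglyMeasurable k := hG.stronglyMeasurable.integral_prod_right'
  have hkint : Integrable k (Q.map U) := hGint.integral_prod_left
  have hkU : (fun ω ↦ ∫ ω', G (U ω, V ω') ∂Q) = fun ω ↦ k (U ω) := by
    ext ω
    rw [hk]
    simp only
    exact (integral_map (f := fun v ↦ G (U ω, v)) hV.aemeasurable
      (hG.comp measurable_prodMk_left).aestronglyMeasurable).symm
  rw [hkU]
  refine (ae_eq_condExp_of_forall_setIntegral_eq hU.comap_le hint ?_ ?_ ?_).symm
  · exact fun _ _ _ ↦ (hkint.comp_measurable hU).integrableOn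
  · rintro _ ⟨s, hs, rfl⟩ -
    have h1 : ∫ ω in U ⁻¹' s, k (U ω) ∂Q = ∫ u in s, k u ∂(Q.map U) :=
      (setIntegral_map hs hkm.aestronglyMeasurable hU.aemeasurable).symm
    have h2 : ∫ ω in U ⁻¹' s, G (U ω, V ω) ∂Q
        = ∫ p in s ×ˢ Set.univ, G p ∂((Q.map U).prod (Q.map V)) := by
      rw [← hlaw, setIntegral_map (hs.prod MeasurableSet.univ) hG.aestronglyMeasurable
        (hU.prodMk hV).aemeasurable]
      congr 2
      ext ω
      simp
    rw [h1, h2, setIntegral_prod G hGint.integrableOn]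
    simp [hk]
  · exact (hkm.comp_measurable (comap_measurable U)).aestronglyMeasurable

end

/-! ### The payoff as a function of the increments -/

section

variable {N M : ℕ}

lemma sum_sum_Iic (a y : Fin M → ℝ) :
    ∑ k, a k * ∑ j ∈ Finset.Iic k, y j = ∑ j, (∑ k ∈ Finset.Ici j, a k) * y j := by
  simp_rw [Finset.mul_sum, Finset.sum_mul]
  exact Finset.sum_comm' fun k j ↦ by simp

lemma sum_Iic_sub (a : Fin (M + 1) → ℝ) (k : Fin M) :
    ∑ j ∈ Finset.Iic k, (a j.succ - a j.castSucc) = a k.succ - a 0 := by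
  let b : ℕ → ℝ := fun i ↦ if h : i < M + 1 then a ⟨i, h⟩ else 0
  have hb : ∀ i : Fin (M + 1), b i = a i := fun i ↦ by simp only [b, i.is_lt, dif_pos]
  have h := Finset.sum_range_sub b (k + 1)
  rw [show b (k + 1) = a k.succ from hb k.succ, show b 0 = a 0 from hb 0] at h
  rw [← h]
  refine Finset.sum_bij (fun j _ ↦ (j : ℕ)) (fun j hj ↦ ?_) (fun i _ j _ hij ↦ Fin.ext hij)
    (fun i hi ↦ ?_) fun j _ ↦ ?_
  · have : j ≤ k := by simpa using hj
    simpa [Nat.lt_succ_iff] using this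
  · have hik : i ≤ k := by simpa [Nat.lt_succ_iff] using hi
    exact ⟨⟨i, hik.trans_lt k.2⟩, by simpa [Fin.le_def] using hik, rfl⟩
  · rw [show b (j + 1) = a j.succ from hb j.succ, show b j = a j.castSucc from hb j.castSucc]

/-- The tail sums of a nonzero row do not all vanish: the one that starts at the last nonzero
entry equals this entry. -/
lemma exists_sum_Ici_ne_zero {a : Fin M → ℝ} (ha : ∃ k, a k ≠ 0) :
    ∃ j, ∑ k ∈ Finset.Ici j, a k ≠ 0 := by
  have hne : (Finset.univ.filter fun k ↦ a k ≠ 0).Nonempty := by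
    obtain ⟨k, hk⟩ := ha
    exact ⟨k, by simp [hk]⟩
  have hmem := Finset.max'_mem _ hne
  set m := (Finset.univ.filter fun k ↦ a k ≠ 0).max' hne
  refine ⟨m, ?_⟩
  rw [Finset.sum_eq_single m]
  · simpa using hmem
  · intro k hk hkm
    by_contra h
    exact hkm (le_antisymm (Finset.le_max' _ _ (by simpa using h)) (by simpa using hk))
  · simp

lemma sum_strip_eq (w om : Fin N → ℝ) (A : Matrix (Fin N) (Fin M) ℝ) (γ : Fin M → ℝ)
    (s : Finset (Fin M)) :
    ∑ k ∈ s, ((∑ n, w n * om n * A n k) + γ k)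
      = (∑ n, w n * om n * ∑ k ∈ s, A n k) + ∑ k ∈ s, γ k := by
  rw [Finset.sum_add_distrib, Finset.sum_comm]
  simp_rw [Finset.mul_sum]

/-- The payoff as a function of the current log-price `x` and the increments `y` of the log-price
between the monitoring dates. -/
noncomputable def incrementPayoff (γ : Fin M → ℝ) (K w : Fin N → ℝ)
    (A : Matrix (Fin N) (Fin M) ℝ) (x : ℝ) (y : Fin M → ℝ) : ℝ :=
  Real.exp (x * ∑ k, γ k) * (Real.exp (∑ j, (∑ k ∈ Finset.Ici j, γ k) * y j)
    * ∏ n, if 0 ≤ w n * ((∑ j, (∑ k ∈ Finset.Ici j, A n k) * y j)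
        + ((∑ k, A n k) * x - K n)) then 1 else 0)

lemma payoff_eq_incrementPayoff (γ : Fin M → ℝ) (K w : Fin N → ℝ)
    (A : Matrix (Fin N) (Fin M) ℝ) (x : ℝ) (y : Fin M → ℝ) :
    payoff γ K w A (fun k ↦ x + ∑ j ∈ Finset.Iic k, y j) = incrementPayoff γ K w A x y := by
  have hsum : ∀ a : Fin M → ℝ, ∑ k, a k * (x + ∑ j ∈ Finset.Iic k, y j)
      = x * ∑ k, a k + ∑ j, (∑ k ∈ Finset.Ici j, a k) * y j := by
    intro a
    rw [← sum_sum_Iic, Finset.mul_sum, ← Finset.sum_add_distrib]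
    exact Finset.sum_congr rfl fun k _ ↦ by ring
  have hmul : ∀ n, (A.mulVec fun k ↦ x + ∑ j ∈ Finset.Iic k, y j) n
      = x * ∑ k, A n k + ∑ j, (∑ k ∈ Finset.Ici j, A n k) * y j := fun n ↦ hsum (A n)
  rw [payoff, incrementPayoff, hsum, Real.exp_add, mul_assoc]
  congr 2
  refine Finset.prod_congr rfl fun n _ ↦ ?_
  rw [hmul]
  refine if_congr ?_ rfl rfl
  rw [← sub_nonneg]
  ring_nf

lemma measurable_incrementPayoff (γ : Fin M → ℝ) (K w : Fin N → ℝ)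
    (A : Matrix (Fin N) (Fin M) ℝ) :
    Measurable fun p : ℝ × (Fin M → ℝ) ↦ incrementPayoff γ K w A p.1 p.2 := by
  unfold incrementPayoff
  refine Measurable.mul (by fun_prop) (Measurable.mul (by fun_prop)
    (Finset.measurable_prod _ fun n _ ↦ ?_))
  exact Measurable.ite (measurableSet_le measurable_const (by fun_prop)) measurable_const
    measurable_const

variable {Ω : Type*} (X : ℝ≥0 → Ω → ℝ) (r : ℝ) (T : Fin (M + 1) → ℝ≥0)
  (γ : Fin M → ℝ) (K w : Fin N → ℝ) (A : Matrix (Fin N) (Fin M) ℝ)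

lemma discountedPayoffFrom_eq (s : ℝ) (ω : Ω) :
    discountedPayoffFrom X r T (payoff γ K w A) s ω
      = Real.exp (-r * ((T (Fin.last M) : ℝ) - T 0))
        * incrementPayoff γ K w A (Real.log s) fun j ↦ X (T j.succ) ω - X (T j.castSucc) ω := by
  rw [← payoff_eq_incrementPayoff]
  simp only [discountedPayoffFrom, discountedPayoff, sum_Iic_sub fun i ↦ X (T i) ω]

lemma discountedPayoff_eq (ω : Ω) :
    discountedPayoff X r T (payoff γ K w A) ω
      = Real.exp (-r * ((T (Fin.last M) : ℝ) - T 0))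
        * incrementPayoff γ K w A (X (T 0) ω) fun j ↦ X (T j.succ) ω - X (T j.castSucc) ω := by
  rw [← payoff_eq_incrementPayoff]
  simp only [discountedPayoff, sum_Iic_sub fun i ↦ X (T i) ω, add_sub_cancel]

end

/-! ### The pricing formula -/

lemma pricingIntegrand_eq_fourierIntegrand {N M : ℕ} (ψ : ℂ → ℂ) (T : Fin (M + 1) → ℝ≥0)
    (γ : Fin M → ℝ) (K : Fin N → ℝ) (A : Matrix (Fin N) (Fin M) ℝ) (s : ℝ) (ξ : Fin N → ℂ) :
    pricingIntegrand ψ T γ K A s ξ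
      = fourierIntegrand
          (fun (j : Fin M) ζ ↦ Complex.exp (-((T j.succ : ℝ) - T j.castSucc : ℝ) * ψ ζ))
          (fun n j ↦ ∑ k ∈ Finset.Ici j, A n k) (fun j ↦ ∑ k ∈ Finset.Ici j, γ k)
          (fun n ↦ (∑ k, A n k) * Real.log s - K n) ξ := by
  rw [pricingIntegrand, fourierIntegrand, sub_eq_add_neg, Complex.exp_add, ← Complex.exp_sum,
    ← Finset.sum_neg_distrib]
  congr 3
  refine Finset.sum_congr rfl fun j _ ↦ ?_
  rw [neg_mul]
  congr 3
  push_cast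
  simp_rw [Finset.sum_mul]

lemma IsRLPEMarket.hasStripCharFun {Ω : Type*} [MeasurableSpace Ω] {Q : Measure Ω}
    {X : ℝ≥0 → Ω → ℝ} {r υ lm lp : ℝ} {ψ : ℂ → ℂ} {M : ℕ} {T : Fin (M + 1) → ℝ≥0}
    (hX : IsRLPEMarket Q X r υ lm lp ψ) (hT : StrictMono T)
    (j : Fin M) :
    HasStripCharFun Q (fun ω ↦ X (T j.succ) ω - X (T j.castSucc) ω) lm lp
      fun ζ ↦ Complex.exp (-((T j.succ : ℝ) - T j.castSucc : ℝ) * ψ ζ) :=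
  hasStripCharFun_increment hX.levy hX.exponent hX.rlpe (hT j.castSucc_lt_succ)

section

variable {Ω : Type*} [MeasurableSpace Ω] {Q : Measure Ω}
  {X : ℝ≥0 → Ω → ℝ} {r υ lm lp : ℝ} {ψ : ℂ → ℂ} {N M : ℕ} {T : Fin (M + 1) → ℝ≥0}
  {γ : Fin M → ℝ} {K w : Fin N → ℝ} {A : Matrix (Fin N) (Fin M) ℝ} {om : Fin N → ℝ}

lemma strip_tail_sums (hstrip : ∀ j : Fin M,
      (∑ k ∈ Finset.Ici j, ((∑ n, w n * om n * A n k) + γ k)) ∈ Set.Ioo (-lp) (-lm)) (j : Fin M) :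
    (∑ n, w n * om n * ∑ k ∈ Finset.Ici j, A n k) + ∑ k ∈ Finset.Ici j, γ k
      ∈ Set.Ioo (-lp) (-lm) := by
  rw [← sum_strip_eq]
  exact hstrip j

lemma integrable_pricingIntegrand (hX : IsRLPEMarket Q X r υ lm lp ψ) (hT : StrictMono T)
    (hw : ∀ n, w n = 1 ∨ w n = -1) (hA : ∀ n, ∃ k, A n k ≠ 0) (hom : ∀ n, 0 < om n)
    (hstrip : ∀ j : Fin M,
      (∑ k ∈ Finset.Ici j, ((∑ n, w n * om n * A n k) + γ k)) ∈ Set.Ioo (-lp) (-lm)) (s : ℝ) :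
    Integrable fun x : Fin N → ℝ ↦ pricingIntegrand ψ T γ K A s (contourPoint w om x) := by
  simp_rw [pricingIntegrand_eq_fourierIntegrand]
  exact integrable_fourierIntegrand (hX.hasStripCharFun hT) hw hom
    (fun n ↦ exists_sum_Ici_ne_zero (hA n)) _ (strip_tail_sums hstrip)

variable [IsProbabilityMeasure Q]

lemma integrable_discountedPayoffFrom (hX : IsRLPEMarket Q X r υ lm lp ψ) (hT : StrictMono T)
    (hom : ∀ n, 0 < om n)
    (hstrip : ∀ j : Fin M,
      (∑ k ∈ Finset.Ici j, ((∑ n, w n * om n * A n k) + γ k)) ∈ Set.Ioo (-lp) (-lm)) (s : ℝ) :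
    Integrable (discountedPayoffFrom X r T (payoff γ K w A) s) Q := by
  rw [funext (discountedPayoffFrom_eq X r T γ K w A s)]
  have hY := hX.hasStripCharFun hT
  refine Integrable.const_mul (Integrable.const_mul ?_ _) _
  exact integrable_digital (fun j ↦ (hY j).measurable) (hX.levy.iIndepFun_increment hT.monotone)
    hom _ fun j ↦ (hY j).integrable_exp hX.rlpe.2.1 hX.rlpe.2.2.1 (strip_tail_sums hstrip j)

lemma integral_discountedPayoffFrom (hX : IsRLPEMarket Q X r υ lm lp ψ) (hT : StrictMono T)
    (hw : ∀ n, w n = 1 ∨ w n = -1) (hA : ∀ n, ∃ k, A n k ≠ 0) (hom : ∀ n, 0 < om n)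
    (hstrip : ∀ j : Fin M,
      (∑ k ∈ Finset.Ici j, ((∑ n, w n * om n * A n k) + γ k)) ∈ Set.Ioo (-lp) (-lm))
    {s : ℝ} (hs : 0 < s) :
    ((∫ ω, discountedPayoffFrom X r T (payoff γ K w A) s ω ∂Q : ℝ) : ℂ)
      = pricingFormula ψ r T γ K w om A s := by
  have h := fourier_pricing (hX.hasStripCharFun hT) (hX.levy.iIndepFun_increment hT.monotone)
    hX.rlpe.2.1 hX.rlpe.2.2.1 hw hom (fun n ↦ exists_sum_Ici_ne_zero (hA n))
    (fun n ↦ (∑ k, A n k) * Real.log s - K n) (strip_tail_sums hstrip)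
  simp_rw [← pricingIntegrand_eq_fourierIntegrand] at h
  simp_rw [discountedPayoffFrom_eq, incrementPayoff, integral_const_mul]
  rw [Complex.ofReal_mul, Complex.ofReal_mul, h, pricingFormula, Real.rpow_def_of_pos hs]
  push_cast
  ring

/-- Unlike the increments, the current log-price need not have a characteristic function that
decays: the current date may be `0`, where the log-price is the constant `0`. -/
lemma integrable_exp_current (hX : IsRLPEMarket Q X r υ lm lp ψ)
    {θ : ℝ} (hθ : θ ∈ Set.Ioo (-lp) (-lm)) (t : ℝ≥0) :
    Integrable (fun ω ↦ Real.exp (θ * (X t ω - X 0 ω))) Q := by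
  rcases eq_zero_or_pos t with rfl | ht
  · simp
  · exact (hasStripCharFun_increment hX.levy hX.exponent hX.rlpe ht).integrable_exp
      hX.rlpe.2.1 hX.rlpe.2.2.1 hθ

lemma sum_strip_mem (hlm : lm < 0) (hlp : 0 < lp) (hstrip : ∀ j : Fin M,
      (∑ k ∈ Finset.Ici j, ((∑ n, w n * om n * A n k) + γ k)) ∈ Set.Ioo (-lp) (-lm)) :
    (∑ n, w n * om n * ∑ k, A n k) + ∑ k, γ k ∈ Set.Ioo (-lp) (-lm) := by
  rw [← sum_strip_eq]
  cases M with
  | zero => simpa using ⟨hlp, hlm⟩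
  | succ m =>
    have h := hstrip 0
    rwa [show Finset.Ici (0 : Fin (m + 1)) = Finset.univ by ext; simp] at h

lemma integrable_discountedPayoff (hX : IsRLPEMarket Q X r υ lm lp ψ) (hT : StrictMono T)
    (hom : ∀ n, 0 < om n)
    (hstrip : ∀ j : Fin M,
      (∑ k ∈ Finset.Ici j, ((∑ n, w n * om n * A n k) + γ k)) ∈ Set.Ioo (-lp) (-lm)) :
    Integrable (discountedPayoff X r T (payoff γ K w A)) Q := by
  have hY := hX.hasStripCharFun hT
  -- the current log-price is a further increment, with coefficients the full row sums
  have h := integrable_digital (Y := incrementFrom X T) (w := w) (om := om)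
    (B := fun n ↦ Fin.cons (∑ k, A n k) fun j ↦ ∑ k ∈ Finset.Ici j, A n k)
    (g := Fin.cons (∑ k, γ k) fun j ↦ ∑ k ∈ Finset.Ici j, γ k)
    (hX.levy.measurable_incrementFrom T) (hX.levy.iIndepFun_incrementFrom hT.monotone) hom
    (fun n ↦ -K n) (fun i ↦ by
      refine Fin.cases ?_ (fun j ↦ ?_) i
      · simpa [incrementFrom] using integrable_exp_current hX
          (sum_strip_mem hX.rlpe.2.1 hX.rlpe.2.2.1 hstrip) (T 0)
      · simpa [incrementFrom] using (hY j).integrable_exp hX.rlpe.2.1 hX.rlpe.2.2.1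
          (strip_tail_sums hstrip j))
  refine (h.const_mul (Real.exp (-r * ((T (Fin.last M) : ℝ) - T 0)))).congr ?_
  filter_upwards [hX.levy.start_zero] with ω hω
  rw [discountedPayoff_eq, incrementPayoff]
  simp only [Fin.sum_univ_succ, incrementFrom, Fin.cons_zero, Fin.cons_succ, hω, sub_zero]
  rw [Real.exp_add, mul_assoc (Real.exp ((∑ k, γ k) * _)), mul_comm (∑ k, γ k)]
  congr 3
  refine Finset.prod_congr rfl fun n _ ↦ if_congr ?_ rfl rfl
  ring_nf

end

end LevyPricing

theorem proposition1 {Ω : Type*} [MeasurableSpace Ω] (Q : Measure Ω) [IsProbabilityMeasure Q]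
    (X : ℝ≥0 → Ω → ℝ) (r υ lm lp : ℝ) (ψ : ℂ → ℂ)
    (hX : LevyPricing.IsRLPEMarket Q X r υ lm lp ψ)
    {N M : ℕ} (T : Fin (M + 1) → ℝ≥0) (hT : StrictMono T)
    (γ : Fin M → ℝ) (K w : Fin N → ℝ) (hw : ∀ n, w n = 1 ∨ w n = -1)
    (A : Matrix (Fin N) (Fin M) ℝ) (hA : ∀ n, ∃ k, A n k ≠ 0)
    (om : Fin N → ℝ) (hom : ∀ n, 0 < om n)
    (hstrip : ∀ j : Fin M,
      (∑ k ∈ Finset.Ici j, ((∑ n, w n * om n * A n k) + γ k)) ∈ Set.Ioo (-lp) (-lm)) :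
    -- for every current stock price `s > 0`: absolute convergence, and the formula for the value
    (∀ s : ℝ, 0 < s →
      Integrable (LevyPricing.discountedPayoffFrom X r T (LevyPricing.payoff γ K w A) s) Q ∧
      Integrable (fun x : Fin N → ℝ ↦
        LevyPricing.pricingIntegrand ψ T γ K A s (LevyPricing.contourPoint w om x)) ∧
      ((∫ ω, LevyPricing.discountedPayoffFrom X r T (LevyPricing.payoff γ K w A) s ω ∂Q : ℝ) : ℂ)
        = LevyPricing.pricingFormula ψ r T γ K w om A s) ∧
    -- the formula at `S_t = exp X_t` is the conditional expectation of the discounted payoff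
    -- given `X_t`
    Integrable (LevyPricing.discountedPayoff X r T (LevyPricing.payoff γ K w A)) Q ∧
    (∀ᵐ ω ∂Q,
      (((Q[LevyPricing.discountedPayoff X r T (LevyPricing.payoff γ K w A) |
          MeasurableSpace.comap (X (T 0)) inferInstance]) ω : ℝ) : ℂ)
        = LevyPricing.pricingFormula ψ r T γ K w om A (Real.exp (X (T 0) ω))) := by
  have hpay := LevyPricing.integrable_discountedPayoff (K := K) hX hT hom hstrip
  refine ⟨fun s hs ↦ ⟨LevyPricing.integrable_discountedPayoffFrom hX hT hom hstrip s,
    LevyPricing.integrable_pricingIntegrand hX hT hw hA hom hstrip s,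
    LevyPricing.integral_discountedPayoffFrom hX hT hw hA hom hstrip hs⟩, hpay, ?_⟩
  have heq := funext (LevyPricing.discountedPayoff_eq X r T γ K w A)
  have hcond := LevyPricing.condExp_comp_of_indepFun (hX.levy.measurable (T 0))
    (measurable_pi_lambda _ fun j ↦ (hX.hasStripCharFun hT j).measurable)
    (hX.levy.indepFun_current_increments hT.monotone)
    ((LevyPricing.measurable_incrementPayoff γ K w A).const_mul
      (Real.exp (-r * ((T (Fin.last M) : ℝ) - T 0)))) (heq ▸ hpay)
  rw [heq]
  filter_upwards [hcond] with ω hω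
  rw [hω, ← LevyPricing.integral_discountedPayoffFrom hX hT hw hA hom hstrip (Real.exp_pos _)]
  simp_rw [LevyPricing.discountedPayoffFrom_eq, Real.log_exp]
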